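/- Let $X$ be a connected $n$-dimensional orbifold, presented by a proper étale Lie groupoid (the local groups are finite and need not act effectively). For $k\ge 1$ let $\widetilde{\Sigma_kX}$ be the orbifold of pairs $(p,(\mathbf g))$, where $p\in X$ and $(\mathbf g)$ is the conjugacy class in the local group $G_p$ of a $k$-tuple $\mathbf g=(g_1,\dots,g_k)$ of elements of $G_p$. Let $T_k$ be the set of its connected components (the $k$-multi-sectors) $X_{(\mathbf g)}$, and let $T_3^o\subset T_3$ be the set of those with $g_1g_2g_3=1$. Let $e_i:X_{(g_1,\dots,g_k)}\to X_{(g_i)}$ be the evaluation maps, and let $I:X_{(g)}\to X_{(g^{-1})}$ be the map $(p,(g))\mapsto(p,(g^{-1}))$. Let $Y\to X$ be the orbifold universal cover and $\pi=\pi_1^{orb}(X)$ its group of deck translations. Every local group $G_p$ has a homomorphism to $\pi$, well defined up to conjugation. This assigns to each sector $X_{(g)}$, $(g)\in T_1$, a conjugacy class $(d)$ of $\pi$. The sector is called dormant if $d=1$. For $d\in\pi$ let $C(d)$ be its centralizer and $Y_d$ its fixed point locus in $Y$, taken in the orbifold sense (locally, the pairs $(y,g)$ of a point $y$ of a chart over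 $p$ and an element $g\in G_p$ whose image in $\pi$, determined using $y$, is $d$); if $X_{(g)}$ has class $(d)$, then it is a component of $Y_d/C(d)$. Let $\alpha\in H^2(\pi,U(1))$ be a discrete torsion, that is, a class of normalized $2$-cocycles modulo coboundaries. For $d\in\pi$ the phase $\gamma(\alpha)_{d,h}=\alpha_{d,h}\alpha_{h,d}^{-1}$, $h\in C(d)$, depends only on the class $\alpha$ and is a character of $C(d)$. Define a flat complex line orbifold bundle $L_{(g)}$ on each sector as follows: $L_{(g)}$ is trivial if $X_{(g)}$ is dormant; otherwise choose a representative $d$ of the class of $X_{(g)}$ in $\pi$, and let $L_{(g)}$ be the restriction to $X_{(g)}$ of $$Y_d\times_{\gamma(\alpha)_{d,\cdot}}\mathbb C\longrightarrow Y_d/C(d),$$ the quotient of $Y_d\times\mathbb C$ by the action $h\cdot(y,v)=(hy,\gamma(\alpha)_{d,h}v)$ of $C(d)$. Then, for every choice of the representatives, $\mathcal L_\alpha=\{L_{(g)}\}_{(g)\in T_1}$ is an inner local system of $X$. That is, as flat line bundles: 1. $L_{(1)}$ is trivial on the nontwisted sector $X_{(1)}=X$; 2. $I^*L_{(g^{-1})}\cong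 L_{(g)}^{-1}$ for every $(g)\in T_1$; 3. $e_1^*L_{(g_1)}\otimes e_2^*L_{(g_2)}\otimes e_3^*L_{(g_3)}$ is trivial on $X_{(\mathbf g)}$ for every $(\mathbf g)=(g_1,g_2,g_3)\in T_3^o$. -/

import Mathlib

universe u

open Topology
open scoped Manifold ContDiff

/-! ## Topological groupoids and orbifolds -/

/-- A topological groupoid. An arrow `a` goes from `src a` to `tgt a`, and `mul b a _` is the
composite `b ∘ a` (first `a`, then `b`). -/
structure TopGroupoid where
  Obj : Type u
  Arr : Type u
  [topObj : TopologicalSpace Obj]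
  [topArr : TopologicalSpace Arr]
  src : Arr → Obj
  tgt : Arr → Obj
  one : Obj → Arr
  inv : Arr → Arr
  mul : ∀ b a : Arr, src b = tgt a → Arr
  src_one : ∀ x, src (one x) = x
  tgt_one : ∀ x, tgt (one x) = x
  src_inv : ∀ a, src (inv a) = tgt a
  tgt_inv : ∀ a, tgt (inv a) = src a
  src_mul : ∀ b a h, src (mul b a h) = src a
  tgt_mul : ∀ b a h, tgt (mul b a h) = tgt b
  mul_assoc : ∀ c b a (h₁ : src c = tgt b) (h₂ : src b = tgt a),
    mul (mul c b h₁) a ((src_mul c b h₁).trans h₂) =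
      mul c (mul b a h₂) (h₁.trans (tgt_mul b a h₂).symm)
  one_mul : ∀ a, mul (one (tgt a)) a (src_one _) = a
  mul_one : ∀ a, mul a (one (src a)) (tgt_one _).symm = a
  inv_mul : ∀ a, mul (inv a) a (src_inv a) = one (src a)
  mul_inv : ∀ a, mul a (inv a) (tgt_inv a).symm = one (tgt a)
  continuous_src : Continuous src
  continuous_tgt : Continuous tgt
  continuous_one : Continuous one
  continuous_inv : Continuous inv
  continuous_mul : Continuous fun p : {p : Arr × Arr // src p.1 = tgt p.2} => mul p.1.1 p.1.2 p.2

attribute [instance] TopGroupoid.topObj TopGroupoid.topArr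

/-- `G` presents an `n`-dimensional orbifold: it is a proper étale Lie groupoid. The objects and
the arrows form smooth Hausdorff second countable `n`-manifolds, source and target are local
diffeomorphisms and `(src, tgt)` is proper. The remaining structure maps, being continuous and
compatible with the local diffeomorphisms `src` and `tgt`, are then automatically smooth. The
isotropy groups are finite; they need not act effectively. -/
class IsOrbifold (n : ℕ) (G : TopGroupoid.{u})
    [ChartedSpace (EuclideanSpace ℝ (Fin n)) G.Obj]
    [ChartedSpace (EuclideanSpace ℝ (Fin n)) G.Arr] : Prop where
  manifold_obj : IsManifold (𝓡 n) ∞ G.Obj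
  manifold_arr : IsManifold (𝓡 n) ∞ G.Arr
  t2_obj : T2Space G.Obj
  t2_arr : T2Space G.Arr
  secondCountable_obj : SecondCountableTopology G.Obj
  secondCountable_arr : SecondCountableTopology G.Arr
  src_localDiffeo : IsLocalDiffeomorph (𝓡 n) (𝓡 n) ∞ G.src
  tgt_localDiffeo : IsLocalDiffeomorph (𝓡 n) (𝓡 n) ∞ G.tgt
  proper : IsProperMap fun a : G.Arr => (G.src a, G.tgt a)

namespace TopGroupoid

/-- The underlying space of the orbifold: objects modulo arrows, with the quotient topology. -/
abbrev OrbitSpace (G : TopGroupoid.{u}) : Type u :=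
  Quot fun x y : G.Obj => ∃ a : G.Arr, G.src a = x ∧ G.tgt a = y

/-- The set of connected components of the underlying space. -/
abbrev Comp (G : TopGroupoid.{u}) : Type u := ConnectedComponents G.OrbitSpace

/-- The component of an object. -/
def cls (G : TopGroupoid.{u}) (x : G.Obj) : G.Comp :=
  ConnectedComponents.mk (Quot.mk _ x : G.OrbitSpace)

theorem cls_eq (G : TopGroupoid.{u}) (a : G.Arr) : G.cls (G.src a) = G.cls (G.tgt a) :=
  congrArg ConnectedComponents.mk (Quot.sound ⟨a, rfl, rfl⟩)

theorem mul_congr (G : TopGroupoid.{u}) {b b' a a' : G.Arr} (hb : b = b') (ha : a = a')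
    (h : G.src b = G.tgt a) :
    G.mul b a h = G.mul b' a' (by rw [← hb, ← ha]; exact h) := by
  subst hb ha; rfl

theorem mul_continuous (G : TopGroupoid.{u}) {Z : Type*} [TopologicalSpace Z] {f g : Z → G.Arr}
    (hf : Continuous f) (hg : Continuous g) (h : ∀ z, G.src (f z) = G.tgt (g z)) :
    Continuous fun z => G.mul (f z) (g z) (h z) :=
  G.continuous_mul.comp ((hf.prodMk hg).subtype_mk h)

theorem one_mul' (G : TopGroupoid.{u}) {x : G.Obj} (a : G.Arr) (h : G.src (G.one x) = G.tgt a) :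
    G.mul (G.one x) a h = a := by
  obtain rfl : x = G.tgt a := (G.src_one x).symm.trans h
  exact G.one_mul a

theorem mul_one' (G : TopGroupoid.{u}) {x : G.Obj} (a : G.Arr) (h : G.src a = G.tgt (G.one x)) :
    G.mul a (G.one x) h = a := by
  obtain rfl : G.src a = x := h.trans (G.tgt_one x)
  exact G.mul_one a

theorem mul_left_inj (G : TopGroupoid.{u}) {b b' a : G.Arr} (h : G.src b = G.tgt a)
    (h' : G.src b' = G.tgt a) (e : G.mul b a h = G.mul b' a h') : b = b' := by
  have key : ∀ (b : G.Arr) (h : G.src b = G.tgt a),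
      G.mul (G.mul b a h) (G.inv a) (by rw [G.src_mul, G.tgt_inv]) = b := by
    intro b h
    rw [G.mul_assoc b a (G.inv a) h (G.tgt_inv a).symm, G.mul_congr rfl (G.mul_inv a), mul_one']
  rw [← key b h, ← key b' h']
  exact G.mul_congr e rfl _

/-- `G.conj a g = a ∘ g ∘ a⁻¹` for a loop `g` at the source of `a`. -/
def conj (G : TopGroupoid.{u}) (a g : G.Arr) (hs : G.src g = G.src a) (ht : G.tgt g = G.src a) :
    G.Arr :=
  G.mul (G.mul a g ht.symm) (G.inv a) (by rw [G.src_mul, G.tgt_inv, hs])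

theorem src_conj (G : TopGroupoid.{u}) (a g : G.Arr) (hs ht) :
    G.src (G.conj a g hs ht) = G.tgt a := by
  rw [conj, G.src_mul, G.src_inv]

theorem tgt_conj (G : TopGroupoid.{u}) (a g : G.Arr) (hs ht) :
    G.tgt (G.conj a g hs ht) = G.tgt a := by
  rw [conj, G.tgt_mul, G.tgt_mul]

theorem conj_mul_self (G : TopGroupoid.{u}) (a g : G.Arr) (hs ht) :
    G.mul (G.conj a g hs ht) a (G.src_conj a g hs ht) = G.mul a g ht.symm := by
  unfold conj
  rw [G.mul_assoc _ (G.inv a) a _ (G.src_inv a), G.mul_congr rfl (G.inv_mul a), mul_one']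

theorem eq_conj (G : TopGroupoid.{u}) (a g k : G.Arr) (hs : G.src g = G.src a)
    (ht : G.tgt g = G.src a) (hk : G.src k = G.tgt a)
    (e : G.mul k a hk = G.mul a g ht.symm) : k = G.conj a g hs ht :=
  G.mul_left_inj hk (G.src_conj a g hs ht) (e.trans (G.conj_mul_self a g hs ht).symm)

theorem conj_one (G : TopGroupoid.{u}) (x : G.Obj) (g : G.Arr) (hs ht) :
    G.conj (G.one x) g hs ht = g := by
  refine (G.eq_conj (G.one x) g g hs ht (by rw [hs, G.src_one, G.tgt_one]) ?_).symm
  rw [mul_one', one_mul']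

theorem conj_conj (G : TopGroupoid.{u}) (b a g : G.Arr) (h : G.src b = G.tgt a) (hs ht) (hs' ht') :
    G.conj (G.mul b a h) g hs' ht' =
      G.conj b (G.conj a g hs ht) (by rw [G.src_conj, h]) (by rw [G.tgt_conj, h]) := by
  refine (G.eq_conj (G.mul b a h) g _ hs' ht' (by rw [G.src_conj, G.tgt_mul]) ?_).symm
  rw [← G.mul_assoc _ b a (by rw [G.src_conj]) h,
    G.mul_congr (G.conj_mul_self b (G.conj a g hs ht) _ _) rfl,
    G.mul_assoc _ _ _ (by rw [G.tgt_conj, h]) (by rw [G.src_conj]),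
    G.mul_congr rfl (G.conj_mul_self a g hs ht),
    G.mul_assoc b a g h ht.symm]

theorem conj_inv_conj (G : TopGroupoid.{u}) (a g : G.Arr) (hs ht hs' ht') :
    G.conj (G.inv a) (G.conj a g hs ht) hs' ht' = g := by
  have h := G.conj_conj (G.inv a) a g (G.src_inv a) hs ht
    (by rw [G.src_mul, hs]) (by rw [G.src_mul, ht])
  rw [← h]
  have e : ∀ (k : G.Arr) (hk : k = G.one (G.src a)) (p q), G.conj k g p q = g := by
    intro k hk p q; subst hk; exact G.conj_one _ g p q
  exact e _ (G.inv_mul a) _ _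

theorem conj_inv (G : TopGroupoid.{u}) (a g : G.Arr) (hs ht) :
    G.conj a (G.inv g) (by rw [G.src_inv, ht]) (by rw [G.tgt_inv, hs]) =
      G.inv (G.conj a g hs ht) := by
  have e1 : G.mul (G.inv (G.conj a g hs ht)) (G.conj a g hs ht) (G.src_inv _) =
      G.mul (G.conj a (G.inv g) (by rw [G.src_inv, ht]) (by rw [G.tgt_inv, hs]))
        (G.conj a g hs ht) (by rw [G.src_conj, G.tgt_conj]) := by
    rw [G.inv_mul]
    refine G.mul_left_inj (a := a) (by rw [G.src_one, G.src_conj])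
      (by rw [G.src_mul, G.src_conj]) ?_
    rw [one_mul', G.mul_assoc _ _ a _ (G.src_conj a g hs ht),
      G.mul_congr rfl (G.conj_mul_self a g hs ht),
      ← G.mul_assoc _ a g (by rw [G.src_conj]) ht.symm,
      G.mul_congr (G.conj_mul_self a (G.inv g) _ _) rfl,
      G.mul_assoc a _ g (by rw [G.tgt_inv, hs]) (G.src_inv g),
      G.mul_congr rfl (G.inv_mul g), mul_one']
  exact (G.mul_left_inj _ _ e1).symm

/-- The groupoid of the component `σ`: all objects in `σ` and all arrows between them. -/
def component (G : TopGroupoid.{u}) (σ : G.Comp) : TopGroupoid.{u} where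
  Obj := {x : G.Obj // G.cls x = σ}
  Arr := {a : G.Arr // G.cls (G.src a) = σ ∧ G.cls (G.tgt a) = σ}
  src a := ⟨G.src a.1, a.2.1⟩
  tgt a := ⟨G.tgt a.1, a.2.2⟩
  one x := ⟨G.one x.1, by rw [G.src_one]; exact x.2, by rw [G.tgt_one]; exact x.2⟩
  inv a := ⟨G.inv a.1, by rw [G.src_inv]; exact a.2.2, by rw [G.tgt_inv]; exact a.2.1⟩
  mul b a h := ⟨G.mul b.1 a.1 (congrArg Subtype.val h),
    by rw [G.src_mul]; exact a.2.1, by rw [G.tgt_mul]; exact b.2.2⟩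
  src_one x := Subtype.ext (G.src_one x.1)
  tgt_one x := Subtype.ext (G.tgt_one x.1)
  src_inv a := Subtype.ext (G.src_inv a.1)
  tgt_inv a := Subtype.ext (G.tgt_inv a.1)
  src_mul b a h := Subtype.ext (G.src_mul b.1 a.1 _)
  tgt_mul b a h := Subtype.ext (G.tgt_mul b.1 a.1 _)
  mul_assoc c b a h₁ h₂ := Subtype.ext (G.mul_assoc c.1 b.1 a.1 _ _)
  one_mul a := Subtype.ext (G.one_mul a.1)
  mul_one a := Subtype.ext (G.mul_one a.1)
  inv_mul a := Subtype.ext (G.inv_mul a.1)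
  mul_inv a := Subtype.ext (G.mul_inv a.1)
  continuous_src := (G.continuous_src.comp continuous_subtype_val).subtype_mk _
  continuous_tgt := (G.continuous_tgt.comp continuous_subtype_val).subtype_mk _
  continuous_one := (G.continuous_one.comp continuous_subtype_val).subtype_mk _
  continuous_inv := (G.continuous_inv.comp continuous_subtype_val).subtype_mk _
  continuous_mul := (G.mul_continuous
    (continuous_subtype_val.comp (continuous_fst.comp continuous_subtype_val))
    (continuous_subtype_val.comp (continuous_snd.comp continuous_subtype_val)) _).subtype_mk _

/-- The multi-sector groupoid, presenting the space of pairs `(p, (g₁, …, g_k))` with `gᵢ ∈ G_p`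
taken up to simultaneous conjugation. Its objects are the `k`-tuples of loops at a common object
`x`; an arrow `a : x ⟶ y` carries `(x, g)` to `(y, a g a⁻¹)`. -/
def multi (G : TopGroupoid.{u}) (k : ℕ) : TopGroupoid.{u} where
  Obj := {z : G.Obj × (Fin k → G.Arr) // ∀ i, G.src (z.2 i) = z.1 ∧ G.tgt (z.2 i) = z.1}
  Arr := {w : G.Arr × (Fin k → G.Arr) //
    ∀ i, G.src (w.2 i) = G.src w.1 ∧ G.tgt (w.2 i) = G.src w.1}
  src w := ⟨(G.src w.1.1, w.1.2), w.2⟩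
  tgt w := ⟨(G.tgt w.1.1, fun i => G.conj w.1.1 (w.1.2 i) (w.2 i).1 (w.2 i).2),
    fun i => ⟨G.src_conj w.1.1 (w.1.2 i) (w.2 i).1 (w.2 i).2,
      G.tgt_conj w.1.1 (w.1.2 i) (w.2 i).1 (w.2 i).2⟩⟩
  one z := ⟨(G.one z.1.1, z.1.2), fun i => by simpa only [G.src_one] using z.2 i⟩
  inv w := ⟨(G.inv w.1.1, fun i => G.conj w.1.1 (w.1.2 i) (w.2 i).1 (w.2 i).2),
    fun _ => ⟨by rw [G.src_conj, G.src_inv], by rw [G.tgt_conj, G.src_inv]⟩⟩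
  mul v w h := ⟨(G.mul v.1.1 w.1.1 (congrArg (fun z => z.1.1) h), w.1.2),
    fun i => by simpa only [G.src_mul] using w.2 i⟩
  src_one z := Subtype.ext (Prod.ext (G.src_one _) rfl)
  tgt_one z := Subtype.ext (Prod.ext (G.tgt_one _) (funext fun i => G.conj_one z.1.1 (z.1.2 i)
    (by rw [G.src_one]; exact (z.2 i).1) (by rw [G.src_one]; exact (z.2 i).2)))
  src_inv w := Subtype.ext (Prod.ext (G.src_inv _) rfl)
  tgt_inv w := Subtype.ext (Prod.ext (G.tgt_inv _) (funext fun i => G.conj_inv_conj w.1.1 (w.1.2 i)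
    (w.2 i).1 (w.2 i).2 (by rw [G.src_conj, G.src_inv]) (by rw [G.tgt_conj, G.src_inv])))
  src_mul v w h := Subtype.ext (Prod.ext (G.src_mul _ _ _) rfl)
  tgt_mul v w h := Subtype.ext (Prod.ext (G.tgt_mul _ _ _) (funext fun i => by
    have h2 : ∀ i, v.1.2 i = G.conj w.1.1 (w.1.2 i) (w.2 i).1 (w.2 i).2 :=
      fun i => congrFun (congrArg (fun z => z.1.2) h) i
    simp only [h2]
    exact G.conj_conj _ _ _ _ _ _ _ _))
  mul_assoc u v w h₁ h₂ := Subtype.ext (Prod.ext (G.mul_assoc _ _ _ _ _) rfl)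
  one_mul w := Subtype.ext (Prod.ext (G.one_mul _) rfl)
  mul_one w := Subtype.ext (Prod.ext (G.mul_one _) rfl)
  inv_mul w := Subtype.ext (Prod.ext (G.inv_mul _) rfl)
  mul_inv w := Subtype.ext (Prod.ext (G.mul_inv _) rfl)
  continuous_src := by
    refine Continuous.subtype_mk (Continuous.prodMk ?_ ?_) _
    · exact G.continuous_src.comp (continuous_fst.comp continuous_subtype_val)
    · exact continuous_snd.comp continuous_subtype_val
  continuous_tgt := by
    refine Continuous.subtype_mk (Continuous.prodMk ?_ (continuous_pi fun i => ?_)) _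
    · exact G.continuous_tgt.comp (continuous_fst.comp continuous_subtype_val)
    · have h1 : Continuous fun w : {w : G.Arr × (Fin k → G.Arr) //
          ∀ i, G.src (w.2 i) = G.src w.1 ∧ G.tgt (w.2 i) = G.src w.1} => w.1.1 :=
        continuous_fst.comp continuous_subtype_val
      exact G.mul_continuous (G.mul_continuous h1
        ((continuous_apply i).comp (continuous_snd.comp continuous_subtype_val)) _)
        (G.continuous_inv.comp h1) _
  continuous_one := by
    refine Continuous.subtype_mk (Continuous.prodMk ?_ ?_) _
    · exact G.continuous_one.comp (continuous_fst.comp continuous_subtype_val)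
    · exact continuous_snd.comp continuous_subtype_val
  continuous_inv := by
    have h1 : Continuous fun w : {w : G.Arr × (Fin k → G.Arr) //
        ∀ i, G.src (w.2 i) = G.src w.1 ∧ G.tgt (w.2 i) = G.src w.1} => w.1.1 :=
      continuous_fst.comp continuous_subtype_val
    refine Continuous.subtype_mk (Continuous.prodMk ?_ (continuous_pi fun i => ?_)) _
    · exact G.continuous_inv.comp h1
    · exact G.mul_continuous (G.mul_continuous h1
        ((continuous_apply i).comp (continuous_snd.comp continuous_subtype_val)) _)
        (G.continuous_inv.comp h1) _
  continuous_mul := by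
    refine Continuous.subtype_mk (Continuous.prodMk ?_ ?_) _
    · exact G.mul_continuous
        (continuous_fst.comp (continuous_subtype_val.comp
          (continuous_fst.comp continuous_subtype_val)))
        (continuous_fst.comp (continuous_subtype_val.comp
          (continuous_snd.comp continuous_subtype_val))) _
    · exact continuous_snd.comp (continuous_subtype_val.comp
        (continuous_snd.comp continuous_subtype_val))

/-- A homomorphism of topological groupoids. -/
structure Hom (G H : TopGroupoid.{u}) where
  obj : G.Obj → H.Obj
  arr : G.Arr → H.Arr
  src_arr : ∀ a, H.src (arr a) = obj (G.src a)
  tgt_arr : ∀ a, H.tgt (arr a) = obj (G.tgt a)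
  arr_mul : ∀ b a (h : G.src b = G.tgt a),
    arr (G.mul b a h) = H.mul (arr b) (arr a) (by rw [src_arr, tgt_arr, h])
  continuous_obj : Continuous obj
  continuous_arr : Continuous arr

/-- The map induced on underlying spaces. -/
def Hom.orbitMap {G H : TopGroupoid.{u}} (f : G.Hom H) : G.OrbitSpace → H.OrbitSpace :=
  Quot.map f.obj fun _ _ ⟨a, h1, h2⟩ =>
    ⟨f.arr a, (f.src_arr a).trans (congrArg _ h1), (f.tgt_arr a).trans (congrArg _ h2)⟩

theorem Hom.continuous_orbitMap {G H : TopGroupoid.{u}} (f : G.Hom H) : Continuous f.orbitMap :=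
  continuous_quot_lift _ (continuous_quot_mk.comp f.continuous_obj)

/-- The map induced on connected components. -/
def Hom.comp {G H : TopGroupoid.{u}} (f : G.Hom H) : G.Comp → H.Comp :=
  f.continuous_orbitMap.connectedComponentsMap

theorem Hom.cls_obj {G H : TopGroupoid.{u}} (f : G.Hom H) {x : G.Obj} {σ : G.Comp}
    (h : G.cls x = σ) : H.cls (f.obj x) = f.comp σ := by
  subst h; rfl

/-- The homomorphism from a component to the component that contains its image. -/
def Hom.restrict {G H : TopGroupoid.{u}} (f : G.Hom H) (σ : G.Comp) :
    (G.component σ).Hom (H.component (f.comp σ)) where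
  obj x := ⟨f.obj x.1, f.cls_obj x.2⟩
  arr a := ⟨f.arr a.1, by rw [f.src_arr]; exact f.cls_obj a.2.1,
    by rw [f.tgt_arr]; exact f.cls_obj a.2.2⟩
  src_arr a := Subtype.ext (f.src_arr a.1)
  tgt_arr a := Subtype.ext (f.tgt_arr a.1)
  arr_mul b a h := Subtype.ext (f.arr_mul b.1 a.1 _)
  continuous_obj := (f.continuous_obj.comp continuous_subtype_val).subtype_mk _
  continuous_arr := (f.continuous_arr.comp continuous_subtype_val).subtype_mk _

/-- The evaluation map `e_i : (x, (g₁, …, g_k)) ↦ (x, g_i)`. -/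
def eval (G : TopGroupoid.{u}) (k : ℕ) (i : Fin k) : (G.multi k).Hom (G.multi 1) where
  obj z := ⟨(z.1.1, fun _ => z.1.2 i), fun _ => z.2 i⟩
  arr w := ⟨(w.1.1, fun _ => w.1.2 i), fun _ => w.2 i⟩
  src_arr _ := rfl
  tgt_arr _ := rfl
  arr_mul _ _ _ := rfl
  continuous_obj := by
    refine Continuous.subtype_mk (Continuous.prodMk ?_ (continuous_pi fun _ => ?_)) _
    · exact continuous_fst.comp continuous_subtype_val
    · exact (continuous_apply i).comp (continuous_snd.comp continuous_subtype_val)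
  continuous_arr := by
    refine Continuous.subtype_mk (Continuous.prodMk ?_ (continuous_pi fun _ => ?_)) _
    · exact continuous_fst.comp continuous_subtype_val
    · exact (continuous_apply i).comp (continuous_snd.comp continuous_subtype_val)

/-- The involution `I : (x, (g₁, …, g_k)) ↦ (x, (g₁⁻¹, …, g_k⁻¹))`. -/
def invol (G : TopGroupoid.{u}) (k : ℕ) : (G.multi k).Hom (G.multi k) where
  obj z := ⟨(z.1.1, fun i => G.inv (z.1.2 i)),
    fun i => ⟨(G.src_inv _).trans (z.2 i).2, (G.tgt_inv _).trans (z.2 i).1⟩⟩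
  arr w := ⟨(w.1.1, fun i => G.inv (w.1.2 i)),
    fun i => ⟨(G.src_inv _).trans (w.2 i).2, (G.tgt_inv _).trans (w.2 i).1⟩⟩
  src_arr _ := rfl
  tgt_arr w := Subtype.ext (Prod.ext rfl (funext fun i => G.conj_inv w.1.1 (w.1.2 i)
    (w.2 i).1 (w.2 i).2))
  arr_mul _ _ _ := rfl
  continuous_obj := by
    refine Continuous.subtype_mk (Continuous.prodMk ?_ (continuous_pi fun i => ?_)) _
    · exact continuous_fst.comp continuous_subtype_val
    · exact G.continuous_inv.comp
        ((continuous_apply i).comp (continuous_snd.comp continuous_subtype_val))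
  continuous_arr := by
    refine Continuous.subtype_mk (Continuous.prodMk ?_ (continuous_pi fun i => ?_)) _
    · exact continuous_fst.comp continuous_subtype_val
    · exact G.continuous_inv.comp
        ((continuous_apply i).comp (continuous_snd.comp continuous_subtype_val))

/-- The set `T_k` of `k`-multi-sectors: the connected components of the space of pairs
`(p, (g₁, …, g_k))`. -/
abbrev Sector (G : TopGroupoid.{u}) (k : ℕ) : Type u := (G.multi k).Comp

/-- The orbifold `X_σ` of a multi-sector. -/
abbrev sector (G : TopGroupoid.{u}) {k : ℕ} (σ : G.Sector k) : TopGroupoid.{u} :=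
  (G.multi k).component σ

/-- The point `(x, 1)` of the space of twisted sectors. -/
def unitObj (G : TopGroupoid.{u}) (x : G.Obj) : (G.multi 1).Obj :=
  ⟨(x, fun _ => G.one x), fun _ => ⟨G.src_one x, G.tgt_one x⟩⟩

/-- The nontwisted sector `X_(1)`. -/
def IsUntwisted (G : TopGroupoid.{u}) (σ : G.Sector 1) : Prop :=
  ∃ x : G.Obj, (G.multi 1).cls (G.unitObj x) = σ

/-- The subset of `T₃` of the multi-sectors `(g₁, g₂, g₃)` with `g₁ g₂ g₃ = 1`. -/
def ProdOne (G : TopGroupoid.{u}) (σ : G.Sector 3) : Prop :=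
  ∃ z : (G.sector σ).Obj,
    G.mul (G.mul (z.1.1.2 0) (z.1.1.2 1) ((z.1.2 0).1.trans (z.1.2 1).2.symm)) (z.1.1.2 2)
      (by rw [G.src_mul]; exact (z.1.2 1).1.trans (z.1.2 2).2.symm) = G.one z.1.1.1

/-! ## Flat complex line bundles -/

/-- A flat complex line orbifold bundle, given by locally constant transition maps: an open cover
`U` of the objects and, for `i`, `j` and an arrow `a : x ⟶ y` with `x ∈ U i` and `y ∈ U j`, the
number `c j i a` by which `a` maps the fibre over `x`, in the trivialization `i`, to the fibre over
`y`, in the trivialization `j`. On identity arrows these are the usual transition functions between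
overlapping trivializations. The values of `c` elsewhere are irrelevant. -/
structure FlatLineBundle (G : TopGroupoid.{u}) where
  ι : Type u
  U : ι → Set G.Obj
  isOpen : ∀ i, IsOpen (U i)
  cover : ∀ x, ∃ i, x ∈ U i
  c : ι → ι → G.Arr → ℂˣ
  locConst : ∀ j i a, G.src a ∈ U i → G.tgt a ∈ U j → ∀ᶠ a' in 𝓝 a, c j i a' = c j i a
  cocycle : ∀ k j i b a (h : G.src b = G.tgt a), G.src a ∈ U i → G.tgt a ∈ U j → G.tgt b ∈ U k →
    c k j b * c j i a = c k i (G.mul b a h)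

namespace FlatLineBundle

variable {G H : TopGroupoid.{u}}

/-- The trivial flat line bundle. -/
def trivial (G : TopGroupoid.{u}) : FlatLineBundle G where
  ι := PUnit
  U _ := Set.univ
  isOpen _ := isOpen_univ
  cover _ := ⟨PUnit.unit, Set.mem_univ _⟩
  c _ _ _ := 1
  locConst _ _ _ _ _ := Filter.Eventually.of_forall fun _ => rfl
  cocycle _ _ _ _ _ _ _ _ _ := _root_.mul_one 1

/-- The inverse (dual) bundle. -/
def inverse (L : FlatLineBundle G) : FlatLineBundle G where
  ι := L.ι
  U := L.U
  isOpen := L.isOpen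
  cover := L.cover
  c j i a := (L.c j i a)⁻¹
  locConst j i a h1 h2 := (L.locConst j i a h1 h2).mono fun _ h => congrArg _ h
  cocycle k j i b a h h1 h2 h3 := by rw [← L.cocycle k j i b a h h1 h2 h3, _root_.mul_inv]

/-- The tensor product. -/
def tensor (L M : FlatLineBundle G) : FlatLineBundle G where
  ι := L.ι × M.ι
  U i := L.U i.1 ∩ M.U i.2
  isOpen i := (L.isOpen i.1).inter (M.isOpen i.2)
  cover x := by
    obtain ⟨i, hi⟩ := L.cover x
    obtain ⟨j, hj⟩ := M.cover x
    exact ⟨(i, j), hi, hj⟩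
  c j i a := L.c j.1 i.1 a * M.c j.2 i.2 a
  locConst j i a h1 h2 := by
    filter_upwards [L.locConst j.1 i.1 a h1.1 h2.1, M.locConst j.2 i.2 a h1.2 h2.2] with b hb hb'
    rw [hb, hb']
  cocycle k j i b a h h1 h2 h3 := by
    rw [← L.cocycle k.1 j.1 i.1 b a h h1.1 h2.1 h3.1, ← M.cocycle k.2 j.2 i.2 b a h h1.2 h2.2 h3.2,
      mul_mul_mul_comm]

/-- The pull-back along a homomorphism of groupoids. -/
def pullback (f : G.Hom H) (L : FlatLineBundle H) : FlatLineBundle G where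
  ι := L.ι
  U i := f.obj ⁻¹' L.U i
  isOpen i := (L.isOpen i).preimage f.continuous_obj
  cover x := L.cover (f.obj x)
  c j i a := L.c j i (f.arr a)
  locConst j i a h1 h2 := f.continuous_arr.continuousAt.eventually
    (L.locConst j i (f.arr a) (by rw [f.src_arr]; exact h1) (by rw [f.tgt_arr]; exact h2))
  cocycle k j i b a h h1 h2 h3 := by
    rw [f.arr_mul]
    exact L.cocycle k j i _ _ _ (by rw [f.src_arr]; exact h1) (by rw [f.tgt_arr]; exact h2)
      (by rw [f.tgt_arr]; exact h3)

/-- Isomorphism of flat line bundles: locally constant `δ j i : U i ∩ V j → ℂˣ`, the isomorphism in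
the trivializations `i` of `L` and `j` of `M`, compatible with all the transition maps. -/
def IsIso (L M : FlatLineBundle G) : Prop :=
  ∃ δ : M.ι → L.ι → G.Obj → ℂˣ,
    (∀ j i x, x ∈ L.U i → x ∈ M.U j → ∀ᶠ x' in 𝓝 x, δ j i x' = δ j i x) ∧
    ∀ j' j i' i a, G.src a ∈ L.U i → G.src a ∈ M.U j → G.tgt a ∈ L.U i' → G.tgt a ∈ M.U j' →
      M.c j' j a * δ j i (G.src a) = δ j' i' (G.tgt a) * L.c i' i a

end FlatLineBundle

/-- An inner local system: a flat complex line bundle `L_(g)` on each sector `X_(g)` such that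
`L_(1)` is trivial, `I^* L_(g⁻¹) = L_(g)⁻¹`, and `e₁^* L_(g₁) ⊗ e₂^* L_(g₂) ⊗ e₃^* L_(g₃)` is
trivial over every 3-multi-sector with `g₁ g₂ g₃ = 1`. -/
structure IsInnerLocalSystem (G : TopGroupoid.{u})
    (L : ∀ σ : G.Sector 1, FlatLineBundle (G.sector σ)) : Prop where
  untwisted : ∀ σ, G.IsUntwisted σ → (L σ).IsIso (FlatLineBundle.trivial _)
  involution : ∀ σ, ((L ((G.invol 1).comp σ)).pullback ((G.invol 1).restrict σ)).IsIso
    (L σ).inverse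
  triple : ∀ σ : G.Sector 3, G.ProdOne σ →
    ((((L _).pullback ((G.eval 3 0).restrict σ)).tensor
      ((L _).pullback ((G.eval 3 1).restrict σ))).tensor
      ((L _).pullback ((G.eval 3 2).restrict σ))).IsIso (FlatLineBundle.trivial _)

/-! ## Orbifold covers and the orbifold fundamental group -/

/-- An orbifold cover of the orbifold presented by `G`: a covering space of the objects on which
the arrows act. The covering orbifold is presented by the action groupoid. -/
structure Cover (G : TopGroupoid.{u}) where
  E : Type u
  [topE : TopologicalSpace E]
  proj : E → G.Obj
  isCovering : IsCoveringMap proj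
  surjective : Function.Surjective proj
  act : ∀ (a : G.Arr) (e : E), G.src a = proj e → E
  proj_act : ∀ a e h, proj (act a e h) = G.tgt a
  act_one : ∀ e, act (G.one (proj e)) e (G.src_one _) = e
  act_mul : ∀ b a e (h : G.src b = G.tgt a) (h' : G.src a = proj e),
    act (G.mul b a h) e ((G.src_mul b a h).trans h') =
      act b (act a e h') (h.trans (proj_act a e h').symm)
  continuous_act : Continuous fun p : {p : G.Arr × E // G.src p.1 = proj p.2} =>
    act p.1.1 p.1.2 p.2

attribute [instance] Cover.topE

namespace Cover

variable {G : TopGroupoid.{u}}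

/-- A map of orbifold covers over the base (it is itself an orbifold cover onto its image). -/
structure Map (Y E : Cover G) where
  toFun : Y.E → E.E
  continuous : Continuous toFun
  proj : ∀ y, E.proj (toFun y) = Y.proj y
  act : ∀ a y (h : G.src a = Y.proj y),
    toFun (Y.act a y h) = E.act a (toFun y) (h.trans (proj y).symm)

/-- The underlying space of the covering orbifold. -/
abbrev OrbitSpace (Y : Cover G) : Type u :=
  Quot fun y y' : Y.E => ∃ a h, Y.act a y h = y'

/-- `Y` is the orbifold universal cover: it is connected and, for every orbifold cover `E` and
points `y` of `Y` and `e` of `E` over the same base point, there is a map of covers `Y → E` over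
the base that takes `y` to `e`. -/
structure IsUniversal (Y : Cover G) : Prop where
  connected : ConnectedSpace Y.OrbitSpace
  lift : ∀ (E : Cover G) (y : Y.E) (e : E.E), Y.proj y = E.proj e → ∃ f : Map Y E, f.toFun y = e

/-- The group of deck translations. When `Y` is the orbifold universal cover this is the orbifold
fundamental group `π₁^orb`. -/
def deck (Y : Cover G) : Subgroup (Y.E ≃ₜ Y.E) where
  carrier := {φ | ∃ hp : ∀ y, Y.proj (φ y) = Y.proj y,
    ∀ a y (h : G.src a = Y.proj y), φ (Y.act a y h) = Y.act a (φ y) (h.trans (hp y).symm)}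
  one_mem' := ⟨fun _ => rfl, fun _ _ _ => rfl⟩
  mul_mem' := by
    rintro φ ψ ⟨hp, ha⟩ ⟨hp', ha'⟩
    refine ⟨fun y => (hp _).trans (hp' y), fun a y h => ?_⟩
    change φ (ψ _) = Y.act a (φ (ψ y)) _
    rw [ha', ha]
  inv_mem' := by
    rintro φ ⟨hp, ha⟩
    have hp' : ∀ y, Y.proj (φ⁻¹ y) = Y.proj y := fun y => by
      rw [← hp]; exact congrArg _ (φ.apply_symm_apply y)
    refine ⟨hp', fun a y h => φ.injective ?_⟩
    rw [ha _ _ (h.trans (hp' y).symm)]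
    have e : ∀ y, φ (φ⁻¹ y) = y := φ.apply_symm_apply
    simp only [e]

theorem proj_deck (Y : Cover G) (d : Y.deck) (y : Y.E) : Y.proj (d.1 y) = Y.proj y :=
  d.2.1 y

theorem deck_act (Y : Cover G) (d : Y.deck) (a : G.Arr) (y : Y.E) (h : G.src a = Y.proj y) :
    d.1 (Y.act a y h) = Y.act a (d.1 y) (h.trans (Y.proj_deck d y).symm) :=
  d.2.2 a y h

theorem act_congr (Y : Cover G) {a a' : G.Arr} {y y' : Y.E} (ha : a = a') (hy : y = y')
    (h : G.src a = Y.proj y) :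
    Y.act a y h = Y.act a' y' (by rw [← ha, ← hy]; exact h) := by
  subst ha hy; rfl

theorem act_one' (Y : Cover G) {x : G.Obj} {y : Y.E} (h : G.src (G.one x) = Y.proj y) :
    Y.act (G.one x) y h = y := by
  obtain rfl : x = Y.proj y := (G.src_one x).symm.trans h
  exact Y.act_one y

theorem act_continuousAt (Y : Cover G) {Z : Type*} [TopologicalSpace Z] {f : Z → G.Arr}
    {s : Z → Y.E} {U : Set Z} (hU : IsOpen U) (hf : ContinuousOn f U) (hs : ContinuousOn s U)
    (h : ∀ z ∈ U, G.src (f z) = Y.proj (s z)) {F : Z → Y.E}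
    (hF : ∀ z (hz : z ∈ U), F z = Y.act (f z) (s z) (h z hz)) {z : Z} (hz : z ∈ U) :
    ContinuousAt F z := by
  have h1 : Continuous fun u : U => Y.act (f u.1) (s u.1) (h u.1 u.2) :=
    Y.continuous_act.comp (((continuousOn_iff_continuous_domRestrict.mp hf).prodMk
      (continuousOn_iff_continuous_domRestrict.mp hs)).subtype_mk fun u : U => h u.1 u.2)
  have h2 : ContinuousOn F U := by
    rw [continuousOn_iff_continuous_domRestrict]
    exact h1.congr fun u => (hF u.1 u.2).symm
  exact h2.continuousAt (hU.mem_nhds hz)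

theorem eventually_eq (Y : Cover G) {Z : Type*} [TopologicalSpace Z] {f g : Z → Y.E} {z : Z}
    (hf : ContinuousAt f z) (hg : ContinuousAt g z) (h : f z = g z)
    (hp : ∀ᶠ w in 𝓝 z, Y.proj (f w) = Y.proj (g w)) : ∀ᶠ w in 𝓝 z, f w = g w := by
  obtain ⟨W, hW, hinj⟩ :=
    (isLocallyInjective_iff_nhds.mp Y.isCovering.isLocalHomeomorph.isLocallyInjective) (f z)
  filter_upwards [hf.eventually hW, hg.eventually (h ▸ hW), hp] with w h1 h2 h3
  exact hinj h1 h2 h3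

/-- Two maps of covers with connected source that agree at a point are equal. -/
theorem map_unique {Y E : Cover G} (hY : ConnectedSpace Y.OrbitSpace) (f g : Map Y E) (y₀ : Y.E)
    (h₀ : f.toFun y₀ = g.toFun y₀) (y : Y.E) : f.toFun y = g.toFun y := by
  have he : E.proj ∘ f.toFun = E.proj ∘ g.toFun := funext fun y => by
    simp only [Function.comp_apply, f.proj, g.proj]
  let S : Set Y.E := {y | f.toFun y = g.toFun y}
  have hS : IsClopen S :=
    ⟨E.isCovering.isSeparatedMap.isClosed_eqLocus f.continuous g.continuous he,
      E.isCovering.isLocalHomeomorph.isLocallyInjective.isOpen_eqLocus f.continuous g.continuous he⟩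
  let P : Y.OrbitSpace → Prop := Quot.lift (fun y => y ∈ S) (by
    rintro y y' ⟨a, h, rfl⟩
    refine propext ⟨fun hy => ?_, fun hy => ?_⟩
    · change f.toFun _ = g.toFun _
      rw [f.act, g.act]
      exact E.act_congr rfl hy _
    · have hy' : f.toFun _ = g.toFun _ := hy
      rw [f.act, g.act] at hy'
      have key : ∀ (e : E.E) (he : G.src a = E.proj e),
          E.act (G.inv a) (E.act a e he) (by rw [G.src_inv, E.proj_act]) = e := by
        intro e he
        rw [← E.act_mul (G.inv a) a e (G.src_inv a) he, E.act_congr (G.inv_mul a) rfl, E.act_one']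
      change f.toFun y = g.toFun y
      rw [← key (f.toFun y) (h.trans (f.proj y).symm), ← key (g.toFun y) (h.trans (g.proj y).symm)]
      exact E.act_congr rfl hy' _)
  have hP : IsClopen {q | P q} := by
    have : Quot.mk _ ⁻¹' {q | P q} = S := rfl
    exact ⟨isQuotientMap_quot_mk.isClosed_preimage.mp (this ▸ hS.1),
      isQuotientMap_quot_mk.isOpen_preimage.mp (this ▸ hS.2)⟩
  have hu : {q | P q} = Set.univ := hP.eq_univ ⟨Quot.mk _ y₀, h₀⟩
  have : (Quot.mk _ y : Y.OrbitSpace) ∈ {q | P q} := hu ▸ Set.mem_univ _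
  exact this

/-- A deck translation as a map of covers. -/
def deckMap (Y : Cover G) (d : Y.deck) : Map Y Y where
  toFun := d.1
  continuous := d.1.continuous
  proj := Y.proj_deck d
  act := Y.deck_act d

/-- Deck translations of a connected cover act freely. -/
theorem deck_free {Y : Cover G} (hY : ConnectedSpace Y.OrbitSpace) {d d' : Y.deck} {y : Y.E}
    (h : d.1 y = d'.1 y) : d = d' :=
  Subtype.ext (Homeomorph.ext (map_unique hY (Y.deckMap d) (Y.deckMap d') y h))

/-- The identity map of a cover. -/
def idMap (Y : Cover G) : Map Y Y := ⟨id, continuous_id, fun _ => rfl, fun _ _ _ => rfl⟩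

/-- Composition of maps of covers. -/
def compMap {Y E F : Cover G} (g : Map E F) (f : Map Y E) : Map Y F where
  toFun := g.toFun ∘ f.toFun
  continuous := g.continuous.comp f.continuous
  proj y := (g.proj _).trans (f.proj y)
  act a y h := by simp only [Function.comp_apply, f.act, g.act]

/-- The deck group of the universal cover is transitive on fibres. -/
theorem deck_transitive {Y : Cover G} (hY : Y.IsUniversal) {y y' : Y.E}
    (h : Y.proj y = Y.proj y') : ∃ d : Y.deck, d.1 y = y' := by
  obtain ⟨f, hf⟩ := hY.lift Y y y' h
  obtain ⟨g, hg⟩ := hY.lift Y y' y h.symm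
  have h1 : ∀ z, g.toFun (f.toFun z) = z :=
    map_unique hY.connected (compMap g f) (idMap Y) y (by
      change g.toFun (f.toFun y) = y
      rw [hf, hg])
  have h2 : ∀ z, f.toFun (g.toFun z) = z :=
    map_unique hY.connected (compMap f g) (idMap Y) y' (by
      change f.toFun (g.toFun y') = y'
      rw [hg, hf])
  exact ⟨⟨⟨⟨f.toFun, g.toFun, h1, h2⟩, f.continuous, g.continuous⟩, f.proj, f.act⟩, hf⟩

end Cover

end TopGroupoid

/-! ## Second cohomology with coefficients in `U(1)` -/

/-- Normalized 2-cocycles of a group with values in `U(1)` (trivial action). -/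
def TwoCocycle (π : Type*) [Group π] : Subgroup (π → π → Circle) where
  carrier := {α | (∀ g, α g 1 = 1 ∧ α 1 g = 1) ∧
    ∀ g h k, α g (h * k) * α h k = α g h * α (g * h) k}
  one_mem' := ⟨fun _ => ⟨rfl, rfl⟩, fun _ _ _ => rfl⟩
  mul_mem' := by
    rintro α β ⟨h1, h2⟩ ⟨h3, h4⟩
    refine ⟨fun g => ?_, fun g h k => ?_⟩
    · simp [(h1 g).1, (h1 g).2, (h3 g).1, (h3 g).2]
    · simp only [Pi.mul_apply]
      rw [mul_mul_mul_comm, h2, h4, mul_mul_mul_comm]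
  inv_mem' := by
    rintro α ⟨h1, h2⟩
    refine ⟨fun g => ?_, fun g h k => ?_⟩
    · simp [(h1 g).1, (h1 g).2]
    · simp only [Pi.inv_apply]
      rw [← mul_inv, h2, mul_inv]

/-- The coboundaries `(δρ)_{g,h} = ρ_g ρ_h ρ_{gh}⁻¹` with `ρ_1 = 1`. -/
def TwoCoboundary (π : Type*) [Group π] : Subgroup (TwoCocycle π) where
  carrier := {α | ∃ ρ : π → Circle, ρ 1 = 1 ∧ ∀ g h, α.1 g h = ρ g * ρ h * (ρ (g * h))⁻¹}
  one_mem' := ⟨fun _ => 1, rfl, fun _ _ => by simp⟩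
  mul_mem' := by
    rintro α β ⟨ρ, h1, h2⟩ ⟨τ, h3, h4⟩
    refine ⟨fun g => ρ g * τ g, by simp [h1, h3], fun g h => ?_⟩
    change α.1 g h * β.1 g h = _
    rw [h2, h4, mul_inv, mul_mul_mul_comm, mul_mul_mul_comm (ρ g)]
  inv_mem' := by
    rintro α ⟨ρ, h1, h2⟩
    refine ⟨fun g => (ρ g)⁻¹, by simp [h1], fun g h => ?_⟩
    change (α.1 g h)⁻¹ = _
    rw [h2, mul_inv, mul_inv]

/-- `H²(π, U(1))`. -/
abbrev H2 (π : Type*) [Group π] : Type _ := TwoCocycle π ⧸ TwoCoboundary π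

/-- The phase `γ(α)_{g,h} = α_{g,h} α_{h,g}⁻¹` of a cocycle, as a character of the centralizer of
`g`. -/
noncomputable def cocyclePhase {π : Type*} [Group π] (g : π) :
    TwoCocycle π →* (Subgroup.centralizer {g} →* Circle) where
  toFun α :=
    { toFun := fun h => α.1 g h * (α.1 h g)⁻¹
      map_one' := by simp [(α.2.1 g).1, (α.2.1 g).2]
      map_mul' := by
        rintro ⟨h, hh⟩ ⟨k, hk⟩
        have eh : g * h = h * g := Subgroup.mem_centralizer_singleton_iff.mp hh |>.symm
        have ek : g * k = k * g := Subgroup.mem_centralizer_singleton_iff.mp hk |>.symm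
        have c1 := α.2.2 g h k
        have c2 := α.2.2 h g k
        have c3 := α.2.2 h k g
        rw [eh] at c1
        rw [ek] at c2
        change α.1 g (h * k) * (α.1 (h * k) g)⁻¹ =
          (α.1 g h * (α.1 h g)⁻¹) * (α.1 g k * (α.1 k g)⁻¹)
        have e1 : α.1 g (h * k) = α.1 g h * α.1 (h * g) k * (α.1 h k)⁻¹ :=
          eq_mul_inv_of_mul_eq c1
        have e2 : α.1 (h * g) k = (α.1 h g)⁻¹ * (α.1 h (k * g) * α.1 g k) := by
          rw [c2, inv_mul_cancel_left]
        have e3 : α.1 (h * k) g = (α.1 h k)⁻¹ * (α.1 h (k * g) * α.1 k g) := by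
          rw [c3, inv_mul_cancel_left]
        rw [e1, e2, e3, mul_inv, inv_inv, mul_inv]
        have aux : ∀ a b c d e f : Circle,
            a * (b⁻¹ * (c * d)) * e⁻¹ * (e * (c⁻¹ * f⁻¹)) = a * b⁻¹ * (d * f⁻¹) := by
          intro a b c d e f
          calc _ = a * b⁻¹ * (d * f⁻¹) * (c * c⁻¹) * (e⁻¹ * e) := by ac_rfl
            _ = _ := by rw [mul_inv_cancel, inv_mul_cancel, mul_one, mul_one]
        exact aux _ _ _ _ _ _ }
  map_one' := by ext; simp
  map_mul' α β := by
    ext h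
    change ((α.1 g h * β.1 g h * (α.1 h g * β.1 h g)⁻¹ : Circle) : ℂ) =
      ((α.1 g h * (α.1 h g)⁻¹ * (β.1 g h * (β.1 h g)⁻¹) : Circle) : ℂ)
    rw [mul_inv, mul_mul_mul_comm]

/-- The phase character `L^α_g = γ(α)_{g,·} : C(g) → U(1)` of a class `α ∈ H²(π, U(1))`. It does
not depend on the cocycle that represents `α`. -/
noncomputable def phase {π : Type*} [Group π] (α : H2 π) (g : π) : Subgroup.centralizer {g} →* Circle :=
  QuotientGroup.lift (TwoCoboundary π) (cocyclePhase g) (by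
    rintro α ⟨ρ, -, hρ⟩
    ext h
    have eh : g * h = h * g := Subgroup.mem_centralizer_singleton_iff.mp h.2 |>.symm
    change ((α.1 g h * (α.1 h g)⁻¹ : Circle) : ℂ) = ((1 : Circle) : ℂ)
    rw [hρ, hρ, eh, mul_comm (ρ g), mul_inv_cancel]) α

namespace TopGroupoid
namespace Cover

variable {G : TopGroupoid.{u}}

/-! ## The inner local system of a discrete torsion -/

/-- For a point `z = (x, g)` of the space of twisted sectors and a point `y` of the universal
cover over `x`, let `φ_y : G_x → π₁^orb` be the homomorphism such that the deck translation `φ_y(g)`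
takes `y` to `g⁻¹ y` (the inverse makes `φ_y` a homomorphism, since deck translations commute with
the action of `G_x` on the fibre). `Y.Hol d z y` says that `y` lies over `x` and `φ_y(g) = d`. In
that case `d` fixes the point of the covering orbifold represented by `y`, and the pairs `(z, y)`
with `Y.Hol d z y` form the fixed point locus `Y_d`. -/
def Hol (Y : Cover G) (d : Y.deck) (z : (G.multi 1).Obj) (y : Y.E) : Prop :=
  ∃ h : G.src (G.inv (z.1.2 0)) = Y.proj y, d.1 y = Y.act (G.inv (z.1.2 0)) y h

/-- The conjugacy class in `π₁^orb` of the sector `σ` is represented by `d`. -/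
def IsRep (Y : Cover G) (σ : G.Sector 1) (d : Y.deck) : Prop :=
  ∃ (z : (G.sector σ).Obj) (y : Y.E), Y.Hol d z.1 y

/-- The sector `σ` is dormant: its class in `π₁^orb` is trivial. -/
def IsDormant (Y : Cover G) (σ : G.Sector 1) : Prop := Y.IsRep σ 1

theorem proj_eq_of_hol {Y : Cover G} {d : Y.deck} {z : (G.multi 1).Obj} {y : Y.E}
    (h : Y.Hol d z y) : Y.proj y = z.1.1 := by
  obtain ⟨h, -⟩ := h
  rw [← h, G.src_inv]
  exact (z.2 0).2

theorem hol_deck {Y : Cover G} {d t d' : Y.deck} {z : (G.multi 1).Obj} {y : Y.E}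
    (h : Y.Hol d z y) (ht : d' * t = t * d) : Y.Hol d' z (t.1 y) := by
  obtain ⟨h, e⟩ := h
  refine ⟨h.trans (Y.proj_deck t y).symm, ?_⟩
  rw [← Y.deck_act t _ y h, ← e]
  exact congrArg (fun d : Y.deck => d.1 y) ht

theorem comm_of_hol {Y : Cover G} (hY : Y.IsUniversal) {d t d' : Y.deck} {z : (G.multi 1).Obj}
    {y : Y.E} (h : Y.Hol d z y) (h' : Y.Hol d' z (t.1 y)) : d' * t = t * d := by
  obtain ⟨h, e⟩ := h
  obtain ⟨h', e'⟩ := h'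
  refine deck_free hY.connected (y := y) ?_
  change d'.1 (t.1 y) = t.1 (d.1 y)
  rw [e', e, Y.deck_act t _ y h]

theorem exists_hol {Y : Cover G} (hY : Y.IsUniversal) (z : (G.multi 1).Obj) {y : Y.E}
    (hy : Y.proj y = z.1.1) : ∃ d, Y.Hol d z y := by
  have h : G.src (G.inv (z.1.2 0)) = Y.proj y := by rw [G.src_inv, hy]; exact (z.2 0).2
  obtain ⟨d, hd⟩ := deck_transitive hY (y := y) (y' := Y.act (G.inv (z.1.2 0)) y h)
    (by rw [Y.proj_act, G.tgt_inv, hy]; exact (z.2 0).1.symm)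
  exact ⟨d, h, hd⟩

/-- An arrow `a : x ⟶ x'` carries `Y_d` over `(x, g)` to `Y_d` over `(x', a g a⁻¹)`. -/
theorem hol_act {Y : Cover G} {d : Y.deck} (a : (G.multi 1).Arr) {y : Y.E}
    (h : Y.Hol d ((G.multi 1).src a) y) (ha : G.src a.1.1 = Y.proj y) :
    Y.Hol d ((G.multi 1).tgt a) (Y.act a.1.1 y ha) := by
  obtain ⟨h, e⟩ := h
  change G.src (G.inv (a.1.2 0)) = _ at h
  change d.1 y = Y.act (G.inv (a.1.2 0)) y h at e
  have h' : G.src (G.inv (G.conj a.1.1 (a.1.2 0) (a.2 0).1 (a.2 0).2)) = G.tgt a.1.1 := by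
    rw [G.src_inv, G.tgt_conj]
  refine ⟨h'.trans (Y.proj_act _ _ _).symm, ?_⟩
  change _ = Y.act (G.inv (G.conj a.1.1 (a.1.2 0) (a.2 0).1 (a.2 0).2)) _ _
  rw [Y.deck_act, Y.act_congr rfl e, ← Y.act_mul _ _ _ (by rw [G.tgt_inv]; exact (a.2 0).1.symm) h,
    ← Y.act_mul _ _ _ h' ha]
  refine Y.act_congr ?_ rfl _
  rw [← G.conj_mul_self a.1.1 (G.inv (a.1.2 0)) (by rw [G.src_inv]; exact (a.2 0).2)
    (by rw [G.tgt_inv]; exact (a.2 0).1)]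
  exact G.mul_congr (G.conj_inv _ _ _ _) rfl _

/-- Points of `Y_d` extend to local sections. -/
theorem exists_section {Y : Cover G} {d : Y.deck} {z₀ : (G.multi 1).Obj} {y₀ : Y.E}
    (h₀ : Y.Hol d z₀ y₀) : ∃ (U : Set (G.multi 1).Obj) (s : (G.multi 1).Obj → Y.E), IsOpen U ∧
      z₀ ∈ U ∧ ContinuousOn s U ∧ s z₀ = y₀ ∧ ∀ z ∈ U, Y.Hol d z (s z) := by
  classical
  obtain ⟨e, he, hpe⟩ := Y.isCovering.isLocalHomeomorph y₀
  have hc : Continuous fun z : (G.multi 1).Obj => z.1.1 :=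
    continuous_fst.comp continuous_subtype_val
  have hg : Continuous fun z : (G.multi 1).Obj => G.inv (z.1.2 0) :=
    G.continuous_inv.comp ((continuous_apply 0).comp (continuous_snd.comp continuous_subtype_val))
  have hz₀ : z₀.1.1 = e y₀ := by rw [← proj_eq_of_hol h₀, hpe]
  let s : (G.multi 1).Obj → Y.E := fun z => e.symm z.1.1
  let U : Set (G.multi 1).Obj := (fun z => z.1.1) ⁻¹' e.target
  have hU : IsOpen U := e.open_target.preimage hc
  have hz₀U : z₀ ∈ U := by
    change z₀.1.1 ∈ e.target
    rw [hz₀]; exact e.map_source he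
  have hsz₀ : s z₀ = y₀ := by
    change e.symm z₀.1.1 = y₀
    rw [hz₀]; exact e.left_inv he
  have hs : ContinuousOn s U := e.continuousOn_symm.comp hc.continuousOn fun _ h => h
  have hp : ∀ z ∈ U, Y.proj (s z) = z.1.1 := fun z hz => by
    rw [hpe]; exact e.right_inv hz
  have hsrc : ∀ z ∈ U, G.src (G.inv (z.1.2 0)) = Y.proj (s z) := fun z hz => by
    rw [hp z hz, G.src_inv]; exact (z.2 0).2
  let F : (G.multi 1).Obj → Y.E := fun z =>
    if h : G.src (G.inv (z.1.2 0)) = Y.proj (s z) then Y.act (G.inv (z.1.2 0)) (s z) h else y₀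
  have hF : ∀ z (hz : z ∈ U), F z = Y.act (G.inv (z.1.2 0)) (s z) (hsrc z hz) :=
    fun z hz => dif_pos (hsrc z hz)
  have hFc : ContinuousAt F z₀ := Y.act_continuousAt hU hg.continuousOn hs hsrc hF hz₀U
  have hdc : ContinuousAt (fun z => d.1 (s z)) z₀ :=
    d.1.continuous.continuousAt.comp (hs.continuousAt (hU.mem_nhds hz₀U))
  have hev := Y.eventually_eq hdc hFc (by
    obtain ⟨h, e⟩ := h₀
    rw [hF z₀ hz₀U]
    exact ((congrArg d.1 hsz₀).trans e).trans (Y.act_congr rfl hsz₀.symm _)) (by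
    filter_upwards [hU.mem_nhds hz₀U] with z hz
    rw [hF z hz, Y.proj_act, Y.proj_deck, hp z hz, G.tgt_inv]
    exact (z.2 0).1.symm)
  obtain ⟨W, hW, hWo, hzW⟩ := eventually_nhds_iff.mp hev
  refine ⟨U ∩ W, s, hU.inter hWo, ⟨hz₀U, hzW⟩, hs.mono Set.inter_subset_left, hsz₀, ?_⟩
  rintro z ⟨hz, hzW⟩
  exact ⟨hsrc z hz, (hW z hzW).trans (hF z hz)⟩

/-- `Y_d` maps onto a sector as soon as it meets it. -/
theorem hol_surjective {Y : Cover G} (hY : Y.IsUniversal) {σ : G.Sector 1} {d : Y.deck}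
    (hd : Y.IsRep σ d) (z : (G.sector σ).Obj) : ∃ y, Y.Hol d z.1 y := by
  let S : Set (G.multi 1).Obj := {z | ∃ y, Y.Hol d z y}
  have hSo : IsOpen S := by
    rw [isOpen_iff_mem_nhds]
    rintro z ⟨y, hy⟩
    obtain ⟨U, s, hU, hz, -, -, hs⟩ := exists_section hy
    exact Filter.mem_of_superset (hU.mem_nhds hz) fun w hw => ⟨s w, hs w hw⟩
  have hSc : IsOpen Sᶜ := by
    rw [isOpen_iff_mem_nhds]
    intro z hz
    obtain ⟨y, hy⟩ := Y.surjective z.1.1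
    obtain ⟨d', hd'⟩ := exists_hol hY z hy
    obtain ⟨U, s, hU, hzU, -, -, hs⟩ := exists_section hd'
    refine Filter.mem_of_superset (hU.mem_nhds hzU) ?_
    rintro w hw ⟨y', hy'⟩
    obtain ⟨t, rfl⟩ := deck_transitive hY (y := s w) (y' := y')
      ((proj_eq_of_hol (hs w hw)).trans (proj_eq_of_hol hy').symm)
    exact hz ⟨_, hol_deck hd' (comm_of_hol hY (hs w hw) hy')⟩
  let P : (G.multi 1).OrbitSpace → Prop := Quot.lift (fun z => z ∈ S) (by
    rintro _ _ ⟨a, rfl, rfl⟩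
    refine propext ⟨?_, ?_⟩
    · rintro ⟨y, hy⟩
      exact ⟨_, hol_act a hy (proj_eq_of_hol hy).symm⟩
    · rintro ⟨y, hy⟩
      have hy1 : Y.Hol d ((G.multi 1).src ((G.multi 1).inv a)) y := by
        rw [(G.multi 1).src_inv]; exact hy
      have := hol_act ((G.multi 1).inv a) hy1 (proj_eq_of_hol hy1).symm
      rw [(G.multi 1).tgt_inv] at this
      exact ⟨_, this⟩)
  have hP : IsClopen {q | P q} := by
    have e : Quot.mk _ ⁻¹' {q | P q} = S := rfl
    exact ⟨isQuotientMap_quot_mk.isClosed_preimage.mp (e ▸ ⟨hSc⟩),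
      isQuotientMap_quot_mk.isOpen_preimage.mp (e ▸ hSo)⟩
  obtain ⟨z', y', hy'⟩ := hd
  have hmem : (Quot.mk _ z.1 : (G.multi 1).OrbitSpace) ∈
      connectedComponent (Quot.mk _ z'.1 : (G.multi 1).OrbitSpace) := by
    have e : (G.multi 1).cls z.1 = (G.multi 1).cls z'.1 := z.2.trans z'.2.symm
    rw [← ConnectedComponents.coe_eq_coe.mp e]
    exact mem_connectedComponent
  exact hP.connectedComponent_subset (x := Quot.mk _ z'.1) ⟨y', hy'⟩ hmem

/-- A continuous local section of `Y_d` over the sector `σ`. -/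
structure LocalSection (Y : Cover G) (σ : G.Sector 1) (d : Y.deck) where
  U : Set (G.sector σ).Obj
  isOpen : IsOpen U
  s : (G.sector σ).Obj → Y.E
  continuousOn : ContinuousOn s U
  hol : ∀ z ∈ U, Y.Hol d z.1 (s z)

/-- The arrow `a` carries `y` to `t y'`. -/
def Carries (Y : Cover G) (a : G.Arr) (y : Y.E) (t : Y.deck) (y' : Y.E) : Prop :=
  ∃ h : G.src a = Y.proj y, Y.act a y h = t.1 y'

theorem carries_unique {Y : Cover G} (hY : Y.IsUniversal) {a : G.Arr} {y y' : Y.E}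
    {t t' : Y.deck} (h : Y.Carries a y t y') (h' : Y.Carries a y t' y') : t = t' := by
  obtain ⟨_, e⟩ := h
  obtain ⟨_, e'⟩ := h'
  exact deck_free hY.connected (e.symm.trans e')

theorem exists_carries {Y : Cover G} (hY : Y.IsUniversal) {d : Y.deck} (a : (G.multi 1).Arr)
    {y y' : Y.E} (h : Y.Hol d ((G.multi 1).src a) y) (h' : Y.Hol d ((G.multi 1).tgt a) y') :
    ∃ t : Subgroup.centralizer {d}, Y.Carries a.1.1 y t.1 y' := by
  have ha : G.src a.1.1 = Y.proj y := (proj_eq_of_hol h).symm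
  obtain ⟨t, ht⟩ := deck_transitive hY (y := y') (y' := Y.act a.1.1 y ha)
    (by rw [Y.proj_act]; exact proj_eq_of_hol h')
  refine ⟨⟨t, Subgroup.mem_centralizer_singleton_iff.mpr ?_⟩, ha, ht.symm⟩
  exact (comm_of_hol hY h' (ht ▸ hol_act a h ha)).symm

open Classical in
/-- The number by which `a` acts from the fibre of `Y_d ×_χ ℂ` trivialized by `v ↦ [y, v]` to the
fibre trivialized by `v ↦ [y', v]`. If `a y = t y'` with `t ∈ C(d)`, then
`a [y, v] = [t y', v] = [y', χ(t)⁻¹ v]`. -/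
noncomputable def transition (Y : Cover G) {d : Y.deck} (χ : Subgroup.centralizer {d} →* Circle)
    (a : G.Arr) (y y' : Y.E) : ℂˣ :=
  if h : ∃ t : Subgroup.centralizer {d}, Y.Carries a y t.1 y' then
    (Circle.toUnits (χ h.choose))⁻¹ else 1

theorem transition_eq {Y : Cover G} (hY : Y.IsUniversal) {d : Y.deck}
    (χ : Subgroup.centralizer {d} →* Circle) {a : G.Arr} {y y' : Y.E}
    (t : Subgroup.centralizer {d}) (h : Y.Carries a y t.1 y') :
    Y.transition χ a y y' = (Circle.toUnits (χ t))⁻¹ := by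
  have hex : ∃ t : Subgroup.centralizer {d}, Y.Carries a y t.1 y' := ⟨t, h⟩
  rw [transition, dif_pos hex, Subtype.ext (carries_unique hY hex.choose_spec h)]

/-- The flat line bundle `Y_d ×_χ ℂ` over the sector `σ`, the quotient of `Y_d × ℂ` by the action
`t (y, v) = (t y, χ(t) v)` of the centralizer `C(d)`. Its trivializations are given by the local
sections of `Y_d` over the sector. -/
noncomputable def assocBundle (Y : Cover G) (hY : Y.IsUniversal) (σ : G.Sector 1) (d : Y.deck)
    (hd : Y.IsRep σ d) (χ : Subgroup.centralizer {d} →* Circle) : FlatLineBundle (G.sector σ) where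
  ι := Y.LocalSection σ d
  U i := i.U
  isOpen i := i.isOpen
  cover z := by
    obtain ⟨y, hy⟩ := hol_surjective hY hd z
    obtain ⟨U, s, hU, hz, hs, -, hh⟩ := exists_section hy
    exact ⟨⟨Subtype.val ⁻¹' U, hU.preimage continuous_subtype_val, fun z => s z.1,
      hs.comp continuous_subtype_val.continuousOn fun _ h => h, fun z hz => hh z.1 hz⟩, hz⟩
  c j i a := Y.transition χ a.1.1.1 (i.s ((G.sector σ).src a)) (j.s ((G.sector σ).tgt a))
  locConst j i a hi hj := by
    classical
    have hH : ∀ b : (G.sector σ).Arr, (G.sector σ).src b ∈ i.U → (G.sector σ).tgt b ∈ j.U →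
        ∃ t : Subgroup.centralizer {d}, Y.Carries b.1.1.1 (i.s ((G.sector σ).src b)) t.1
          (j.s ((G.sector σ).tgt b)) :=
      fun b h1 h2 => exists_carries hY b.1 (i.hol _ h1) (j.hol _ h2)
    obtain ⟨t, ht⟩ := hH a hi hj
    let W : Set (G.sector σ).Arr := (G.sector σ).src ⁻¹' i.U ∩ (G.sector σ).tgt ⁻¹' j.U
    have hW : IsOpen W := (i.isOpen.preimage (G.sector σ).continuous_src).inter
      (j.isOpen.preimage (G.sector σ).continuous_tgt)
    have hs : ContinuousOn (fun b => i.s ((G.sector σ).src b)) W :=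
      i.continuousOn.comp (G.sector σ).continuous_src.continuousOn fun _ h => h.1
    have hs' : ContinuousOn (fun b => t.1.1 (j.s ((G.sector σ).tgt b))) W :=
      t.1.1.continuous.comp_continuousOn
        (j.continuousOn.comp (G.sector σ).continuous_tgt.continuousOn fun _ h => h.2)
    have hf : Continuous fun b : (G.sector σ).Arr => b.1.1.1 :=
      continuous_fst.comp (continuous_subtype_val.comp continuous_subtype_val)
    have hsrc : ∀ b ∈ W, G.src b.1.1.1 = Y.proj (i.s ((G.sector σ).src b)) :=
      fun b hb => (proj_eq_of_hol (i.hol _ hb.1)).symm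
    let F : (G.sector σ).Arr → Y.E := fun b =>
      if h : G.src b.1.1.1 = Y.proj (i.s ((G.sector σ).src b)) then
        Y.act b.1.1.1 (i.s ((G.sector σ).src b)) h else i.s ((G.sector σ).src b)
    have hF : ∀ b (hb : b ∈ W), F b = Y.act b.1.1.1 (i.s ((G.sector σ).src b)) (hsrc b hb) :=
      fun b hb => dif_pos (hsrc b hb)
    have haW : a ∈ W := ⟨hi, hj⟩
    have hev := Y.eventually_eq (Y.act_continuousAt hW hf.continuousOn hs hsrc hF haW)
      (hs'.continuousAt (hW.mem_nhds haW)) ((hF a haW).trans ht.2) (by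
        filter_upwards [hW.mem_nhds haW] with b hb
        rw [hF b hb, Y.proj_act, Y.proj_deck]
        exact (proj_eq_of_hol (j.hol _ hb.2)).symm)
    filter_upwards [hev, hW.mem_nhds haW] with b hb hbW
    rw [transition_eq hY χ t ht,
      transition_eq hY χ t ⟨hsrc b hbW, (hF b hbW).symm.trans hb⟩]
  cocycle k j i b a h hi hj hk := by
    have hj' : (G.sector σ).src b ∈ j.U := h ▸ hj
    obtain ⟨t, ht⟩ := exists_carries hY a.1 (i.hol _ hi) (j.hol _ hj)
    obtain ⟨r, hr⟩ := exists_carries hY b.1 (j.hol _ hj') (k.hol _ hk)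
    have key : Y.Carries ((G.sector σ).mul b a h).1.1.1 (i.s ((G.sector σ).src a)) (t * r).1
        (k.s ((G.sector σ).tgt b)) := by
      obtain ⟨h1, e1⟩ := ht
      obtain ⟨h2, e2⟩ := hr
      have hc : G.src b.1.1.1 = G.tgt a.1.1.1 := congrArg (fun z => z.1.1.1) h
      have hjs : j.s ((G.sector σ).src b) = j.s ((G.sector σ).tgt a) := congrArg j.s h
      refine ⟨(G.src_mul _ _ hc).trans h1, ?_⟩
      refine (Y.act_mul _ _ _ hc h1).trans ?_
      rw [Y.act_congr rfl e1, ← Y.deck_act t.1 b.1.1.1 _ (h2.trans (congrArg Y.proj hjs)),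
        Y.act_congr rfl hjs.symm, e2]
      rfl
    have e3 : Y.transition χ ((G.sector σ).mul b a h).1.1.1
        (i.s ((G.sector σ).src ((G.sector σ).mul b a h)))
        (k.s ((G.sector σ).tgt ((G.sector σ).mul b a h))) =
        (Circle.toUnits (χ (t * r)))⁻¹ := by
      rw [(G.sector σ).src_mul, (G.sector σ).tgt_mul]
      exact transition_eq hY χ (t * r) key
    rw [e3, transition_eq hY χ t ht, transition_eq hY χ r hr, map_mul, map_mul, _root_.mul_inv,
      mul_comm]

open Classical in
/-- The bundle `L_(g)` of the discrete torsion `α` on the sector `σ`. It is trivial if `σ` is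
dormant. Otherwise it is `Y_d ×_χ ℂ`, where `d` represents the class of `σ` in `π₁^orb` and
`χ = γ(α)_{d,·}`. -/
noncomputable def torsionBundle (Y : Cover G) (hY : Y.IsUniversal) (α : H2 Y.deck)
    (σ : G.Sector 1) (d : Y.deck) (hd : Y.IsRep σ d) : FlatLineBundle (G.sector σ) :=
  if Y.IsDormant σ then FlatLineBundle.trivial _ else Y.assocBundle hY σ d hd (phase α d)

end Cover
end TopGroupoid

/-! The mechanism is descent from the universal cover. Over a multi-sector, consider the pairs `(z,
y)` where `y` lies in the universal cover over `z` and the loops at `z` have prescribed holonomies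
`d j` at `y`. Two such points `y` over the same `z` differ by a deck translation `r` commuting with
every `d j`. Pulled back to this space, each bundle `L_(g_j)` acquires a flat trivialization on
which `r` acts by the phase `γ(α)_{d j, r}` (`exists_isFrame_torsionBundle`). A tensor product of
such bundles is therefore trivial on the multi-sector as soon as the product of the phases is 1 on
these `r` (`IsFrame.isIso_trivial`), provided that the prescribed holonomies occur over every point
of the multi-sector (`multiHol_surjective`).

On commuting elements the phase is multiplicative in its first argument
(`TwoCocycle.comm_mul_left`). For `g₁g₂g₃ = 1` the holonomies satisfy `d₁d₂d₃ = 1`, so the product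
of the three phases is `γ_{1,r} = 1`. The involution condition is the same computation with `d⁻¹d =
1`.

Two points make this uniform. The phase is invariant under simultaneous conjugation
(`TwoCocycle.comm_conj`), so the chosen representative of a sector may be replaced by the holonomy
that actually occurs. On a dormant sector the holonomy is 1 and its phase is trivial, so the trivial
bundle with its constant trivialization obeys the same rule as the other bundles. -/

namespace TwoCocycle

/-! ### The commutator pairing of a 2-cocycle -/

variable {π : Type*} [Group π] (α : TwoCocycle π)

/-- The commutator pairing `α_{g,h} α_{h,g}⁻¹` of a cocycle, as a function on all pairs. -/
noncomputable def comm (g h : π) : Circle := α.1 g h * (α.1 h g)⁻¹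

theorem phase_mk (d : π) (h : Subgroup.centralizer {d}) :
    phase (QuotientGroup.mk α) d h = comm α d h.1 := rfl

theorem comm_swap (g h : π) : comm α g h = (comm α h g)⁻¹ := by
  simp [comm, mul_comm]

theorem comm_mul_right {g h k : π} (hh : h * g = g * h) (hk : k * g = g * k) :
    comm α g (h * k) = comm α g h * comm α g k :=
  map_mul (cocyclePhase g α) ⟨h, Subgroup.mem_centralizer_singleton_iff.mpr hh⟩
    ⟨k, Subgroup.mem_centralizer_singleton_iff.mpr hk⟩

/-- Antisymmetry transfers multiplicativity from the second argument to the first. This is the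
algebraic identity behind the involution and triple conditions. -/
theorem comm_mul_left {g h k : π} (hg : g * k = k * g) (hh : h * k = k * h) :
    comm α (g * h) k = comm α g k * comm α h k := by
  rw [comm_swap, comm_mul_right α hg hh, mul_inv, ← comm_swap, ← comm_swap]

theorem comm_one_left (g : π) : comm α 1 g = 1 := by
  simp [comm, (α.2.1 g).1, (α.2.1 g).2]

/-- The commutator pairing of commuting elements is invariant under conjugation. -/
theorem comm_conj {g h g' h' t : π} (hgh : g * h = h * g) (hg : g' * t = t * g)
    (hh : h' * t = t * h) : comm α g' h' = comm α g h := by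
  have hgh' : g' * h' = h' * g' := by
    have e : g' * h' * t = h' * g' * t := by
      rw [mul_assoc, hh, ← mul_assoc, hg, mul_assoc, hgh, ← mul_assoc, ← hh, mul_assoc, ← hg,
        mul_assoc]
    exact mul_right_cancel e
  -- These six cocycle identities come from moving `t` from right to left past the pair, `g'h't =
  -- g'th = tgh`, and past the pair in the other order.
  have e1 := α.2.2 g' h' t
  have e2 := α.2.2 h' g' t
  have e3 := α.2.2 g' t h
  have e4 := α.2.2 h' t g
  have e5 := α.2.2 t g h
  have e6 := α.2.2 t h g
  rw [hh] at e1
  rw [hg, ← hgh'] at e2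
  rw [hg] at e3
  rw [hh] at e4
  rw [← hgh] at e6
  -- In additive notation the six identities are linear equations in an abelian group, and every
  -- term containing `t` cancels.
  have key : ∀ {A : Type} [AddCommGroup A] {a b c d p q x s w t u v z n : A}, p + x = a + q →
      s + w = b + q → p + t = w + u → s + v = x + z → n + c = v + u → n + d = t + z →
      a + -b = c + -d := by
    intros
    grind
  exact key (A := Additive Circle) e1 e2 e3 e4 e5 e6

end TwoCocycle

/-! ### Homomorphisms of groupoids and isomorphisms of flat bundles -/

namespace TopGroupoid

variable {G H K : TopGroupoid.{u}}

theorem inv_one (G : TopGroupoid.{u}) (x : G.Obj) : G.inv (G.one x) = G.one x := by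
  have h : G.src (G.inv (G.one x)) = G.tgt (G.one x) := G.src_inv _
  rw [← G.mul_one' (G.inv (G.one x)) h, G.inv_mul, G.src_one]

namespace Hom

/-- Composition of homomorphisms. -/
def trans (f : G.Hom H) (g : H.Hom K) : G.Hom K where
  obj x := g.obj (f.obj x)
  arr a := g.arr (f.arr a)
  src_arr a := by rw [g.src_arr, f.src_arr]
  tgt_arr a := by rw [g.tgt_arr, f.tgt_arr]
  arr_mul b a h := by
    rw [K.mul_congr rfl rfl, ← g.arr_mul _ _ (by rw [f.src_arr, f.tgt_arr, h]), f.arr_mul]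
  continuous_obj := g.continuous_obj.comp f.continuous_obj
  continuous_arr := g.continuous_arr.comp f.continuous_arr

end Hom

/-- The projection of the multi-sector groupoid to the base. -/
def multiBase (G : TopGroupoid.{u}) (k : ℕ) : (G.multi k).Hom G where
  obj z := z.1.1
  arr a := a.1.1
  src_arr _ := rfl
  tgt_arr _ := rfl
  arr_mul _ _ _ := rfl
  continuous_obj := continuous_fst.comp continuous_subtype_val
  continuous_arr := continuous_fst.comp continuous_subtype_val

/-- The inclusion of a component. -/
def inclusion (G : TopGroupoid.{u}) (σ : G.Comp) : (G.component σ).Hom G where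
  obj := Subtype.val
  arr := Subtype.val
  src_arr _ := rfl
  tgt_arr _ := rfl
  arr_mul _ _ _ := rfl
  continuous_obj := continuous_subtype_val
  continuous_arr := continuous_subtype_val

/-- The projection of a multi-sector to the base. -/
def sectorBase (G : TopGroupoid.{u}) {k : ℕ} (σ : G.Sector k) : (G.sector σ).Hom G :=
  ((G.multi k).inclusion σ).trans (G.multiBase k)

namespace FlatLineBundle

/-- In coordinates the identity is given by the transition numbers along identity arrows, which
compare two trivializations at the same point. -/
theorem IsIso.refl (L : FlatLineBundle G) : L.IsIso L := by
  refine ⟨fun j i x => L.c j i (G.one x), fun j i x hi hj => ?_, fun j' j i' i a hi hj hi' hj' => ?_⟩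
  · exact G.continuous_one.continuousAt.eventually
      (L.locConst j i (G.one x) (by rwa [G.src_one]) (by rwa [G.tgt_one]))
  · rw [L.cocycle j' j i a (G.one (G.src a)) (G.tgt_one _).symm (by rwa [G.src_one])
      (by rwa [G.tgt_one]) hj', L.cocycle j' i' i (G.one (G.tgt a)) a (G.src_one _) hi hi'
      (by rwa [G.tgt_one]), G.mul_one, G.one_mul]

/-- A trivialization of `L ⊗ M` is a perfect pairing, hence an isomorphism from `L` to the dual of
`M`. This turns the involution condition into a triviality statement of the same kind as the triple
condition. -/
theorem isIso_inverse_of_tensor {L M : FlatLineBundle G}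
    (h : (L.tensor M).IsIso (FlatLineBundle.trivial G)) : L.IsIso M.inverse := by
  obtain ⟨δ, h1, h2⟩ := h
  refine ⟨fun j i x => δ PUnit.unit (i, j) x, fun j i x hi hj => h1 _ (i, j) x ⟨hi, hj⟩ (Set.mem_univ _),
    fun j' j i' i a hi hj hi' hj' => ?_⟩
  have := h2 PUnit.unit PUnit.unit (i', j') (i, j) a ⟨hi, hj⟩ (Set.mem_univ _) ⟨hi', hj'⟩ (Set.mem_univ _)
  change (1 : ℂˣ) * _ = _ * (L.c i' i a * M.c j' j a) at this
  change (M.c j' j a)⁻¹ * δ PUnit.unit (i, j) (G.src a) = δ PUnit.unit (i', j') (G.tgt a) * _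
  rw [_root_.one_mul] at this
  rw [this, inv_mul_eq_iff_eq_mul]
  ac_rfl

end FlatLineBundle

/-! ### Descent of equivariant flat trivializations from the cover -/

namespace Cover

/-- `R z y` singles out points `y` of the cover `Y` over the points `z` of `H`. It is a union of
local sheets that is preserved by the arrows. -/
structure IsSheet (Y : Cover G) (ρ : H.Hom G) (R : H.Obj → Y.E → Prop) : Prop where
  proj : ∀ {z y}, R z y → Y.proj y = ρ.obj z
  act : ∀ {a y}, R (H.src a) y → ∀ h : G.src (ρ.arr a) = Y.proj y,
    R (H.tgt a) (Y.act (ρ.arr a) y h)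
  eventually : ∀ {s : H.Obj → Y.E} {z}, ContinuousAt s z →
    (∀ᶠ z' in 𝓝 z, Y.proj (s z') = ρ.obj z') → R z (s z) → ∀ᶠ z' in 𝓝 z, R z' (s z')

/-- The numbers `w i z y` are, in the trivialization `i`, a flat section of the pull-back of `L` to
the space of pairs `(z, y)` with `R z y`. The deck translations act on it through `χ`. -/
structure IsFrame (Y : Cover G) (ρ : H.Hom G) (L : FlatLineBundle H) (R : H.Obj → Y.E → Prop)
    (χ : Y.deck → ℂˣ) (w : L.ι → H.Obj → Y.E → ℂˣ) : Prop where
  deck : ∀ {i z y r}, z ∈ L.U i → R z y → R z (r.1 y) → w i z (r.1 y) = χ r * w i z y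
  -- Arrows multiply fibre coordinates by `c`, so `w` times the coordinate is preserved: `w` has the
  -- variance of an isomorphism to the trivial bundle.
  act : ∀ {i j a y}, H.src a ∈ L.U i → H.tgt a ∈ L.U j → R (H.src a) y →
    ∀ h : G.src (ρ.arr a) = Y.proj y,
      w j (H.tgt a) (Y.act (ρ.arr a) y h) * L.c j i a = w i (H.src a) y
  -- Allowing an arbitrary parameter space `Z` makes the condition stable under pull-back along
  -- homomorphisms.
  locConst : ∀ {Z : Type u} [TopologicalSpace Z] {f : Z → H.Obj} {s : Z → Y.E} {i z},
    f z ∈ L.U i → ContinuousAt f z → ContinuousAt s z → (∀ᶠ z' in 𝓝 z, R (f z') (s z')) →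
      ∀ᶠ z' in 𝓝 z, w i (f z') (s z') = w i (f z) (s z)

/-- The base map lifts to the cover near any point. -/
theorem exists_local_lift (Y : Cover G) (ρ : H.Hom G) {z : H.Obj} {y : Y.E}
    (h : Y.proj y = ρ.obj z) : ∃ s : H.Obj → Y.E, s z = y ∧ ContinuousAt s z ∧
      ∀ᶠ z' in 𝓝 z, Y.proj (s z') = ρ.obj z' := by
  obtain ⟨e, he, hpe⟩ := Y.isCovering.isLocalHomeomorph y
  have hz : ρ.obj z = e y := by rw [← h, hpe]
  have ht : ρ.obj z ∈ e.target := hz ▸ e.map_source he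
  refine ⟨fun z => e.symm (ρ.obj z), (congrArg e.symm hz).trans (e.left_inv he),
    (e.continuousAt_symm ht).comp ρ.continuous_obj.continuousAt, ?_⟩
  filter_upwards [ρ.continuous_obj.continuousAt.eventually (e.open_target.mem_nhds ht)] with z' h
  rw [hpe, e.right_inv h]

namespace IsFrame

variable {Y : Cover G} {ρ : H.Hom G} {L M : FlatLineBundle H} {R S : H.Obj → Y.E → Prop}
  {χ ψ : Y.deck → ℂˣ} {w : L.ι → H.Obj → Y.E → ℂˣ} {v : M.ι → H.Obj → Y.E → ℂˣ}

/-- This is used to restrict the frames of several bundles, each defined where one loop has a given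
holonomy, to the common locus where all the holonomies are prescribed. -/
theorem mono (hw : Y.IsFrame ρ L R χ w) (h : ∀ {z y}, S z y → R z y) : Y.IsFrame ρ L S χ w where
  deck hz hy hr := hw.deck hz (h hy) (h hr)
  act hi hj hy := hw.act hi hj (h hy)
  locConst hz hf hs hR := hw.locConst hz hf hs (hR.mono fun _ => h)

theorem tensor (hw : Y.IsFrame ρ L R χ w) (hv : Y.IsFrame ρ M R ψ v) :
    Y.IsFrame ρ (L.tensor M) R (χ * ψ) (fun i z y => w i.1 z y * v i.2 z y) where
  deck hz hy hr := by
    rw [hw.deck hz.1 hy hr, hv.deck hz.2 hy hr, Pi.mul_apply, mul_mul_mul_comm]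
  act {i j a y} hi hj hy h := by
    change _ * (L.c j.1 i.1 a * M.c j.2 i.2 a) = _
    rw [mul_mul_mul_comm, hw.act hi.1 hj.1 hy h, hv.act hi.2 hj.2 hy h]
  locConst hz hf hs hR := by
    filter_upwards [hw.locConst hz.1 hf hs hR, hv.locConst hz.2 hf hs hR] with z h1 h2
    rw [h1, h2]

theorem pullback (f : K.Hom H) (hw : Y.IsFrame ρ L R χ w) :
    Y.IsFrame (f.trans ρ) (L.pullback f) (fun z y => R (f.obj z) y) χ
      (fun i z y => w i (f.obj z) y) where
  deck hz hy hr := hw.deck hz hy hr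
  act {i j a y} hi hj hy h := by
    have := hw.act (i := i) (j := j) (a := f.arr a) (y := y) (by rw [f.src_arr]; exact hi)
      (by rw [f.tgt_arr]; exact hj) (by rw [f.src_arr]; exact hy) h
    rw [f.src_arr, f.tgt_arr] at this
    exact this
  locConst hz hf hs hR :=
    hw.locConst hz (f.continuous_obj.continuousAt.comp hf) hs hR

/-- A flat section that is invariant under the deck translations descends. -/
theorem isIso_trivial (hY : Y.IsUniversal) (hw : Y.IsFrame ρ L R χ w) (hR : Y.IsSheet ρ R)
    (hne : ∀ z, ∃ y, R z y) (hχ : ∀ {z y r}, R z y → R z (r.1 y) → χ r = 1) :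
    L.IsIso (FlatLineBundle.trivial H) := by
  -- The choice of `y` need not be continuous. By `indep` the value of `w` does not depend on it.
  choose y hy using hne
  have indep : ∀ {i z y₁ y₂}, z ∈ L.U i → R z y₁ → R z y₂ → w i z y₁ = w i z y₂ := by
    intro i z y₁ y₂ hz h1 h2
    obtain ⟨r, rfl⟩ := deck_transitive hY ((hR.proj h1).trans (hR.proj h2).symm)
    rw [hw.deck hz h1 h2, hχ h1 h2, _root_.one_mul]
  refine ⟨fun _ i z => w i z (y z), fun _ i z hz _ => ?_, fun _ _ i' i a hi _ hi' _ => ?_⟩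
  -- Near `z` the chosen points may be replaced by a continuous lift through `y z`, along which `w`
  -- is locally constant.
  · obtain ⟨s, hs₀, hs, hp⟩ := Y.exists_local_lift ρ (hR.proj (hy z))
    have hev := hR.eventually hs hp (by rw [hs₀]; exact hy z)
    filter_upwards [hev, hw.locConst (f := id) hz continuousAt_id hs hev,
      (L.isOpen i).mem_nhds hz] with z' h1 h2 h3
    rw [indep h3 (hy z') h1]
    simpa only [id, hs₀] using h2
  · have h : G.src (ρ.arr a) = Y.proj (y (H.src a)) := by rw [ρ.src_arr, hR.proj (hy _)]
    change (1 : ℂˣ) * _ = w i' (H.tgt a) (y (H.tgt a)) * _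
    rw [_root_.one_mul, indep hi' (hy _) (hR.act (hy _) h), hw.act hi hi' (hy _) h]

end IsFrame

/-! ### Points of the cover with prescribed holonomies -/

variable {Y : Cover G}

/-- A continuous lift of the base through a point of `Y_d` stays in `Y_d`. -/
theorem hol_eventually {Z : Type*} [TopologicalSpace Z] {d : Y.deck} {f : Z → (G.multi 1).Obj}
    {s : Z → Y.E} {z : Z} (hf : ContinuousAt f z)
    (hs : ContinuousAt s z) (hp : ∀ᶠ z' in 𝓝 z, Y.proj (s z') = (f z').1.1)
    (h : Y.Hol d (f z) (s z)) : ∀ᶠ z' in 𝓝 z, Y.Hol d (f z') (s z') := by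
  obtain ⟨U, t, hU, hz, ht, htz, hh⟩ := exists_section h
  have hUz := hf.eventually (hU.mem_nhds hz)
  filter_upwards [Y.eventually_eq hs ((ht.continuousAt (hU.mem_nhds hz)).comp hf) htz.symm (by
    filter_upwards [hp, hUz] with z' h1 h2
    rw [h1]
    exact (proj_eq_of_hol (hh _ h2)).symm), hUz] with z' h1 h2
  rw [h1]
  exact hh _ h2

/-- A point of the universal cover over a point of the multi-sector space, with holonomy `d j` of
the `j`-th loop. -/
def MultiHol (Y : Cover G) {k : ℕ} (d : Fin k → Y.deck) (z : (G.multi k).Obj) (y : Y.E) : Prop :=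
  -- For `k = 0` the condition on holonomies is empty, so the base point has to be fixed separately.
  Y.proj y = z.1.1 ∧ ∀ j, Y.Hol (d j) ((G.eval k j).obj z) y

theorem MultiHol.deck {k : ℕ} {d d' : Fin k → Y.deck} {t : Y.deck} {z : (G.multi k).Obj} {y : Y.E}
    (h : Y.MultiHol d z y) (ht : ∀ j, d' j * t = t * d j) : Y.MultiHol d' z (t.1 y) :=
  ⟨(Y.proj_deck t y).trans h.1, fun j => hol_deck (h.2 j) (ht j)⟩

theorem MultiHol.act {k : ℕ} {d : Fin k → Y.deck} {a : (G.multi k).Arr} {y : Y.E}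
    (h : Y.MultiHol d ((G.multi k).src a) y) (ha : G.src a.1.1 = Y.proj y) :
    Y.MultiHol d ((G.multi k).tgt a) (Y.act a.1.1 y ha) :=
  ⟨Y.proj_act _ _ _, fun j => hol_act ((G.eval k j).arr a) (h.2 j) ha⟩

theorem MultiHol.eventually {Z : Type*} [TopologicalSpace Z] {k : ℕ} {d : Fin k → Y.deck}
    {f : Z → (G.multi k).Obj} {s : Z → Y.E} {z : Z} (hf : ContinuousAt f z)
    (hs : ContinuousAt s z) (hp : ∀ᶠ z' in 𝓝 z, Y.proj (s z') = (f z').1.1)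
    (h : Y.MultiHol d (f z) (s z)) : ∀ᶠ z' in 𝓝 z, Y.MultiHol d (f z') (s z') := by
  filter_upwards [hp, Filter.eventually_all.mpr fun j => hol_eventually
    ((G.eval k j).continuous_obj.continuousAt.comp hf) hs hp (h.2 j)] with z' h1 h2
  exact ⟨h1, h2⟩

theorem isSheet_multiHol {k : ℕ} (σ : G.Sector k) (d : Fin k → Y.deck) :
    Y.IsSheet (G.sectorBase σ) (fun z y => Y.MultiHol d z.1 y) where
  proj h := h.1
  act h ha := h.act ha
  eventually hs hp h := MultiHol.eventually continuousAt_subtype_val hs hp h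

/-- If a tuple of deck translations is the holonomy of one point of a multi-sector, then it is the
holonomy of every point of the multi-sector. -/
theorem multiHol_surjective (hY : Y.IsUniversal) {k : ℕ} {σ : G.Sector k} {d : Fin k → Y.deck}
    {z' : (G.sector σ).Obj} {y' : Y.E} (hy' : Y.MultiHol d z'.1 y') (z : (G.sector σ).Obj) :
    ∃ y, Y.MultiHol d z.1 y := by
  let S : Set (G.multi k).Obj := {z | ∃ y, Y.MultiHol d z y}
  have hSo : IsOpen S := by
    rw [isOpen_iff_mem_nhds]
    rintro z ⟨y, hy⟩
    obtain ⟨s, rfl, hs, hp⟩ := Y.exists_local_lift (G.multiBase k) (z := z) hy.1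
    filter_upwards [MultiHol.eventually continuousAt_id hs hp hy] with w hw
    exact ⟨_, hw⟩
  -- Outside `S` the holonomy tuple `e` at a point over `z` is not simultaneously conjugate to `d`.
  -- A local lift keeps the tuple `e`, and every other tuple over a nearby point is conjugate to it,
  -- so `d` does not occur nearby.
  have hSc : IsOpen Sᶜ := by
    rw [isOpen_iff_mem_nhds]
    intro z hz
    obtain ⟨y, hy⟩ := Y.surjective z.1.1
    choose e he using fun j => exists_hol hY ((G.eval k j).obj z) hy
    obtain ⟨s, rfl, hs, hp⟩ := Y.exists_local_lift (G.multiBase k) (z := z) hy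
    filter_upwards [MultiHol.eventually continuousAt_id hs hp ⟨hy, he⟩] with w hw
    rintro ⟨y₁, h₁⟩
    obtain ⟨t, rfl⟩ := deck_transitive hY (hw.1.trans h₁.1.symm)
    exact hz ⟨_, MultiHol.deck ⟨hy, he⟩ fun j => comm_of_hol hY (hw.2 j) (h₁.2 j)⟩
  -- `S` is invariant under arrows, so it descends to a clopen subset of the orbit space, which
  -- contains every component that it meets.
  let P : (G.multi k).OrbitSpace → Prop := Quot.lift (fun z => z ∈ S) (by
    rintro _ _ ⟨a, rfl, rfl⟩
    refine propext ⟨?_, ?_⟩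
    · rintro ⟨y, hy⟩
      exact ⟨_, hy.act hy.1.symm⟩
    · rintro ⟨y, hy⟩
      have hy1 : Y.MultiHol d ((G.multi k).src ((G.multi k).inv a)) y := by
        rw [(G.multi k).src_inv]; exact hy
      have := hy1.act hy1.1.symm
      rw [(G.multi k).tgt_inv] at this
      exact ⟨_, this⟩)
  have hP : IsClopen {q | P q} := by
    have e : Quot.mk _ ⁻¹' {q | P q} = S := rfl
    exact ⟨isQuotientMap_quot_mk.isClosed_preimage.mp (e ▸ ⟨hSc⟩),
      isQuotientMap_quot_mk.isOpen_preimage.mp (e ▸ hSo)⟩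
  have hmem : (Quot.mk _ z.1 : (G.multi k).OrbitSpace) ∈
      connectedComponent (Quot.mk _ z'.1 : (G.multi k).OrbitSpace) := by
    have e : (G.multi k).cls z.1 = (G.multi k).cls z'.1 := z.2.trans z'.2.symm
    rw [← ConnectedComponents.coe_eq_coe.mp e]
    exact mem_connectedComponent
  exact hP.connectedComponent_subset (x := Quot.mk _ z'.1) ⟨y', hy'⟩ hmem

/-! ## Frames of the bundles of a discrete torsion -/

/-- Each of `d` and `d'` is a holonomy at some point of the cover over one common `z`, and the two
points differ by a deck translation. -/
theorem exists_conj_of_isRep (hY : Y.IsUniversal) {σ : G.Sector 1} {d d' : Y.deck}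
    (hd : Y.IsRep σ d) (hd' : Y.IsRep σ d') : ∃ t : Y.deck, d * t = t * d' := by
  obtain ⟨z, y, hy⟩ := hd'
  obtain ⟨y', hy'⟩ := hol_surjective hY hd z
  obtain ⟨t, rfl⟩ := deck_transitive hY ((proj_eq_of_hol hy).trans (proj_eq_of_hol hy').symm)
  exact ⟨t, comm_of_hol hY hy hy'⟩

/-- The phases `γ(α)_{d,·}` of a cocycle, as units of `ℂ`. -/
noncomputable def phaseUnit (α : TwoCocycle Y.deck) (d r : Y.deck) : ℂˣ :=
  Circle.toUnits (TwoCocycle.comm α d r)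

/-- The translation `t` carries `Y_{d'}` to `Y_d`, so `[t y, ·]` is a basis of the fibre, and the
frame takes the coordinate in this basis. Replacing `y` by `r y` replaces `t y` by `(t r t⁻¹) t y`,
which contributes the phase `γ_{d, trt⁻¹} = γ_{d', r}`. -/
theorem assocBundle_isFrame (hY : Y.IsUniversal) (α : TwoCocycle Y.deck) {σ : G.Sector 1}
    {d d' t : Y.deck} (hd : Y.IsRep σ d) (ht : d * t = t * d') :
    Y.IsFrame (G.sectorBase σ) (Y.assocBundle hY σ d hd (phase (QuotientGroup.mk α) d))
      (fun z y => Y.Hol d' z.1 y) (phaseUnit α d') (fun i z y =>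
        Y.transition (phase (QuotientGroup.mk α) d) (G.one z.1.1.1) (i.s z) (t.1 y)) := by
  have carries_one : ∀ {x : G.Obj} {y y' : Y.E} {r : Y.deck}, x = Y.proj y → y = r.1 y' →
      Y.Carries (G.one x) y r y' := fun hx h =>
    ⟨(G.src_one _).trans hx, (Y.act_one' _).trans h⟩
  -- Any point of `Y_d` over `z` is reached from `t y` by an element of `C(d)`. The frame is the
  -- inverse of the character at that element.
  have key : ∀ {z : (G.sector σ).Obj} {y₁ y : Y.E}, Y.Hol d z.1 y₁ → Y.Hol d' z.1 y →
      ∃ c : Subgroup.centralizer {d}, y₁ = c.1.1 (t.1 y) := by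
    intro z y₁ y h₁ h
    have h' := hol_deck h ht
    obtain ⟨c, hc⟩ := deck_transitive hY ((proj_eq_of_hol h').trans (proj_eq_of_hol h₁).symm)
    exact ⟨⟨c, Subgroup.mem_centralizer_singleton_iff.mpr
      (comm_of_hol hY h' (hc ▸ h₁)).symm⟩, hc.symm⟩
  refine ⟨fun {i z y r} hz hy hr => ?_, fun {i j a y} hi hj hy ha => ?_,
    fun {Z _ f s i z} hz hf hs hR => ?_⟩
  · have hi := i.hol z hz
    obtain ⟨c, hc⟩ := key hi hr
    have hrd := comm_of_hol hY hy hr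
    have hcomm : d * (t * r * t⁻¹) = t * r * t⁻¹ * d := by
      have e : t⁻¹ * d = d' * t⁻¹ := by
        rw [eq_mul_inv_iff_mul_eq, _root_.mul_assoc, ht, inv_mul_cancel_left]
      rw [_root_.mul_assoc _ t⁻¹ d, e, ← _root_.mul_assoc, ← _root_.mul_assoc, ht,
        _root_.mul_assoc t d' r, hrd, ← _root_.mul_assoc, _root_.mul_assoc (t * r)]
    let c₀ : Subgroup.centralizer {d} :=
      ⟨t * r * t⁻¹, Subgroup.mem_centralizer_singleton_iff.mpr hcomm.symm⟩
    -- Here `c` was found for `r y`. The element for `y` itself is `c c₀`, since `c t r = c (t r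
    -- t⁻¹) t`.
    have hc' : i.s z = (c * c₀).1.1 (t.1 y) := by
      rw [hc]
      have e : c.1 * t * r = (c * c₀).1 * t := by simp [c₀, _root_.mul_assoc]
      exact congrArg (fun d : Y.deck => d.1 y) e
    have hx := (proj_eq_of_hol hi).symm
    change Y.transition _ _ (i.s z) (t.1 (r.1 y)) = _ * Y.transition _ _ (i.s z) (t.1 y)
    rw [transition_eq hY _ c (carries_one hx hc), transition_eq hY _ _ (carries_one hx hc'),
      map_mul, map_mul, TwoCocycle.phase_mk α d c₀, TwoCocycle.comm_conj α hrd ht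
        (by simp [c₀]), _root_.mul_inv, phaseUnit]
    rw [mul_comm, _root_.mul_assoc, inv_mul_cancel, _root_.mul_one]
  · obtain ⟨c, hc⟩ := key (i.hol _ hi) hy
    obtain ⟨c', hc'⟩ := key (j.hol _ hj) (hol_act a.1 hy ha)
    have hx := (proj_eq_of_hol (i.hol _ hi)).symm
    have hx' := (proj_eq_of_hol (j.hol _ hj)).symm
    -- The section at the source is `c t y` and at the target `c' t (a y)`. Deck translations
    -- commute with arrows, so `a` sends the first to `c t (a y)`, which is `c c'⁻¹` applied to the
    -- second.
    have hcar : Y.Carries a.1.1.1 (i.s ((G.sector σ).src a)) (c * c'⁻¹).1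
        (j.s ((G.sector σ).tgt a)) := by
      refine ⟨hx, ?_⟩
      have e : c.1 * t = (c * c'⁻¹).1 * (c'.1 * t) := by simp [_root_.mul_assoc]
      have e₁ := Y.deck_act (c.1 * t) a.1.1.1 y ha
      refine (Y.act_congr rfl hc _).trans (e₁.symm.trans ?_)
      exact (congrArg (fun d : Y.deck => d.1 (Y.act a.1.1.1 y ha)) e).trans
        (congrArg (c * c'⁻¹).1.1 hc'.symm)
    refine (congrArg₂ (· * ·) (transition_eq hY _ c' (carries_one hx' hc'))
      (transition_eq hY _ _ hcar)).trans (Eq.trans ?_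
        (transition_eq hY _ c (carries_one hx hc)).symm)
    rw [map_mul, map_mul, map_inv, map_inv, mul_inv_rev, inv_inv, inv_mul_cancel_left]
  · have hU := i.isOpen.mem_nhds hz
    obtain ⟨c, hc⟩ := key (i.hol _ hz) hR.self_of_nhds
    have hi : ContinuousAt (fun z' => i.s (f z')) z := (i.continuousOn.continuousAt hU).comp hf
    have hct : ContinuousAt (fun z' => c.1.1 (t.1 (s z'))) z :=
      c.1.1.continuous.continuousAt.comp (t.1.continuous.continuousAt.comp hs)
    -- Both sides lift the same base map and agree at `z`, so the same `c` works nearby and the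
    -- frame is locally constant.
    have hev := Y.eventually_eq hi hct hc (by
      filter_upwards [hf.eventually hU, hR] with z' h1 h2
      rw [Y.proj_deck, Y.proj_deck, proj_eq_of_hol h2, proj_eq_of_hol (i.hol _ h1)])
    filter_upwards [hev, hf.eventually hU] with z' h1 h2
    rw [transition_eq hY _ c (carries_one (proj_eq_of_hol (i.hol _ hz)).symm hc),
      transition_eq hY _ c (carries_one (proj_eq_of_hol (i.hol _ h2)).symm h1)]

/-- This hides both the choice of representative and the distinction between dormant and other
sectors: for any `d'` representing the class, the phase of `d'` governs the frame. -/
theorem exists_isFrame_torsionBundle (hY : Y.IsUniversal) (α : TwoCocycle Y.deck)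
    {σ : G.Sector 1} {d d' : Y.deck} (hd : Y.IsRep σ d) (hd' : Y.IsRep σ d') :
    ∃ w, Y.IsFrame (G.sectorBase σ) (Y.torsionBundle hY (QuotientGroup.mk α) σ d hd)
      (fun z y => Y.Hol d' z.1 y) (phaseUnit α d') w := by
  by_cases hσ : Y.IsDormant σ
  · rw [torsionBundle, if_pos hσ]
    obtain ⟨t, ht⟩ := exists_conj_of_isRep hY hσ hd'
    -- An element conjugate to 1 is 1, so the constant frame of the trivial bundle has the required
    -- phase.
    obtain rfl : d' = 1 := by simpa using ht.symm
    refine ⟨fun _ _ _ => 1, fun _ _ _ => ?_, fun _ _ _ _ => _root_.one_mul (1 : ℂˣ),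
      fun _ _ _ _ => Filter.Eventually.of_forall fun _ => rfl⟩
    simp [phaseUnit, TwoCocycle.comm_one_left]
  · rw [torsionBundle, if_neg hσ]
    obtain ⟨t, ht⟩ := exists_conj_of_isRep hY hd hd'
    exact ⟨_, assocBundle_isFrame hY α hd ht⟩

/-! ### Holonomy of inverses and products, and the three axioms -/

theorem hol_inv {d : Y.deck} {z : (G.multi 1).Obj} {y : Y.E} (h : Y.Hol d z y) :
    Y.Hol d⁻¹ ((G.invol 1).obj z) y := by
  have hy := proj_eq_of_hol h
  obtain ⟨h, e⟩ := h
  have hz : G.src (G.inv (G.inv (z.1.2 0))) = G.tgt (G.inv (z.1.2 0)) := G.src_inv _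
  have hs : G.src (G.inv (G.inv (z.1.2 0))) = Y.proj y := by
    rw [hz, G.tgt_inv, hy]; exact (z.2 0).1
  refine ⟨hs, d.1.injective ?_⟩
  refine (d.1.apply_symm_apply y).trans (Eq.trans ?_ (Y.deck_act d _ y hs).symm)
  rw [Y.act_congr rfl e, ← Y.act_mul _ _ _ hz h, Y.act_congr (G.inv_mul _) rfl, Y.act_one']

/-- Holonomy is recast as `g (d y) = y`, without the inverse of the loop, a form that composes
directly. -/
theorem act_deck_of_hol {d : Y.deck} {z : (G.multi 1).Obj} {y : Y.E} (h : Y.Hol d z y) :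
    ∃ h, Y.act (z.1.2 0) (d.1 y) h = y := by
  have hy := proj_eq_of_hol h
  obtain ⟨h, e⟩ := h
  refine ⟨by rw [Y.proj_deck, hy]; exact (z.2 0).1, ?_⟩
  rw [Y.act_congr rfl e, ← Y.act_mul _ _ _ (G.tgt_inv _).symm h, Y.act_congr (G.mul_inv _) rfl,
    Y.act_one']

/-- Deck translations commute with arrows, so `a b (d e y) = a d (b e y) = a (d y) = y`. Products of
loops thus correspond to products of holonomies in the same order. -/
theorem act_mul_deck {a b : G.Arr} {d e : Y.deck} {y : Y.E} (h : G.src a = G.tgt b)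
    (ha : ∃ h, Y.act a (d.1 y) h = y) (hb : ∃ h, Y.act b (e.1 y) h = y) :
    ∃ h', Y.act (G.mul a b h) ((d * e).1 y) h' = y := by
  obtain ⟨ha, ea⟩ := ha
  obtain ⟨hb, eb⟩ := hb
  have hb' : G.src b = Y.proj ((d * e).1 y) := hb.trans (Y.proj_deck d _).symm
  refine ⟨(G.src_mul _ _ _).trans hb', (Y.act_mul a b _ h hb').trans (Eq.trans ?_ ea)⟩
  exact Y.act_congr rfl ((Y.deck_act d b _ hb).symm.trans (congrArg d.1 eb)) _

theorem isDormant_of_isUntwisted (Y : Cover G) {σ : G.Sector 1} (hσ : G.IsUntwisted σ) :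
    Y.IsDormant σ := by
  obtain ⟨x, hx⟩ := hσ
  obtain ⟨y, rfl⟩ := Y.surjective x
  have e : G.inv (G.one (Y.proj y)) = G.one (Y.proj y) := G.inv_one _
  refine ⟨⟨G.unitObj (Y.proj y), hx⟩, y, (congrArg G.src e).trans (G.src_one _), ?_⟩
  exact ((Y.act_congr e rfl _).trans (Y.act_one y)).symm

/-- The bundles of a discrete torsion form an inner local system. -/
theorem isInnerLocalSystem_torsionBundle (hY : Y.IsUniversal) (α : H2 Y.deck)
    (rep : G.Sector 1 → Y.deck) (hrep : ∀ σ, Y.IsRep σ (rep σ)) :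
    G.IsInnerLocalSystem fun σ => Y.torsionBundle hY α σ (rep σ) (hrep σ) := by
  obtain ⟨α, rfl⟩ := QuotientGroup.mk_surjective α
  refine ⟨fun σ hσ => ?_, fun σ => ?_, fun τ hτ => ?_⟩
  · rw [torsionBundle, if_pos (isDormant_of_isUntwisted Y hσ)]
    exact FlatLineBundle.IsIso.refl _
  · obtain ⟨z₀, y₀, h₀⟩ := hrep σ
    obtain ⟨w, hw⟩ := exists_isFrame_torsionBundle hY α (hrep σ) (hrep σ)
    -- The representative chosen for the inverse sector is only conjugate to `(rep σ)⁻¹`. The frame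
    -- is taken at `(rep σ)⁻¹`, so that both frames live over the same points `y`.
    obtain ⟨v, hv⟩ := exists_isFrame_torsionBundle hY α (hrep ((G.invol 1).comp σ))
      (d' := (rep σ)⁻¹) ⟨((G.invol 1).restrict σ).obj z₀, y₀, hol_inv h₀⟩
    refine FlatLineBundle.isIso_inverse_of_tensor ?_
    refine ((hv.pullback ((G.invol 1).restrict σ)).mono (fun h => hol_inv h)
      |>.tensor hw).mono (S := fun (z : (G.sector σ).Obj) y => Y.MultiHol (fun _ => rep σ) z.1 y) (fun h => h.2 0)
      |>.isIso_trivial hY (isSheet_multiHol σ _)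
        (multiHol_surjective hY (z' := z₀) ⟨proj_eq_of_hol h₀, fun j => ?_⟩) ?_
    · obtain rfl := Subsingleton.elim 0 j
      exact h₀
    · intro z y r h h'
      have hr := comm_of_hol hY (h.2 0) (h'.2 0)
      have hr' : (rep σ)⁻¹ * r = r * (rep σ)⁻¹ := by
        rw [inv_mul_eq_iff_eq_mul, ← _root_.mul_assoc, hr, mul_inv_cancel_right]
      -- For `r` commuting with `d = rep σ`, the combined phase is `γ_{d⁻¹,r} γ_{d,r} = γ_{1,r} =
      -- 1`.
      rw [Pi.mul_apply, phaseUnit, phaseUnit, ← map_mul, ← TwoCocycle.comm_mul_left α hr' hr,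
        inv_mul_cancel, TwoCocycle.comm_one_left, map_one]
  · obtain ⟨z₀, hz₀⟩ := hτ
    obtain ⟨y₀, hy₀⟩ := Y.surjective z₀.1.1.1
    -- The holonomies are read off at one point `y₀`, and this tuple serves the whole multi-sector.
    choose d hd using fun j => exists_hol hY ((G.eval 3 j).obj z₀.1) hy₀
    have hF := fun j => exists_isFrame_torsionBundle hY α (hrep ((G.eval 3 j).comp τ))
      (d' := d j) ⟨((G.eval 3 j).restrict τ).obj z₀, y₀, hd j⟩
    choose w hw using hF
    have hw' := fun j => ((hw j).pullback ((G.eval 3 j).restrict τ)).mono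
      (S := fun (z : (G.sector τ).Obj) y => Y.MultiHol d z.1 y) (fun h => h.2 j)
    -- The product loop is an identity arrow, so `d₀d₁d₂` fixes `y₀`, and deck translations act
    -- freely.
    have hd1 : d 0 * d 1 * d 2 = 1 := by
      obtain ⟨h, e⟩ := act_mul_deck _ (act_mul_deck _ (act_deck_of_hol (hd 0))
        (act_deck_of_hol (hd 1))) (act_deck_of_hol (hd 2))
      refine deck_free hY.connected (y := y₀) ?_
      exact (Y.act_one' ((congrArg G.src hz₀).symm.trans h)).symm.trans
        ((Y.act_congr hz₀.symm rfl _).trans e)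
    refine (((hw' 0).tensor (hw' 1)).tensor (hw' 2)).isIso_trivial hY (isSheet_multiHol τ d)
      (multiHol_surjective hY (z' := z₀) ⟨hy₀, hd⟩) ?_
    intro z y r h h'
    -- Both `y` and `r y` have holonomy tuple `d`, so `r` commutes with each `d j` and the three
    -- phases multiply to `γ_{d₀d₁d₂, r}`.
    have hr := fun j => comm_of_hol hY (h.2 j) (h'.2 j)
    have hr01 : d 0 * d 1 * r = r * (d 0 * d 1) := by
      rw [_root_.mul_assoc, hr 1, ← _root_.mul_assoc, hr 0, _root_.mul_assoc]
    simp only [Pi.mul_apply, phaseUnit, ← map_mul]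
    rw [← TwoCocycle.comm_mul_left α (hr 0) (hr 1), ← TwoCocycle.comm_mul_left α hr01 (hr 2),
      hd1, TwoCocycle.comm_one_left, map_one]

end Cover
end TopGroupoid

theorem theorem3p1p19 (n : ℕ) (G : TopGroupoid.{u})
    [ChartedSpace (EuclideanSpace ℝ (Fin n)) G.Obj]
    [ChartedSpace (EuclideanSpace ℝ (Fin n)) G.Arr]
    [IsOrbifold n G]
    (Y : G.Cover) (hY : Y.IsUniversal) (α : H2 Y.deck)
    (rep : G.Sector 1 → Y.deck) (hrep : ∀ σ, Y.IsRep σ (rep σ)) :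
    G.IsInnerLocalSystem fun σ => Y.torsionBundle hY α σ (rep σ) (hrep σ) :=
  TopGroupoid.Cover.isInnerLocalSystem_torsionBundle hY α rep hrep
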